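/- **Theorem (quantum Cramér–Rao bound with correlations).** Let $\mathcal H$ be a complex Hilbert space of any dimension and $\varphi\mapsto\rho(\varphi)$, $\varphi\in\mathbb R$, a family of states (positive operators of unit trace) that is continuously differentiable: for every bounded operator $A$ the function $x\mapsto\mathrm{tr}(\rho(x)A)$ is $C^1$ with derivative $\mathrm{tr}(\dot\rho(x)A)$ (this holds if $\rho$ is $C^1$ in trace norm). Let $F(x)=\mathrm{tr}(\rho(x)X(x)^2)\in[0,\infty]$ be the quantum Fisher information, where $X(x)$ is a (possibly unbounded) symmetric solution of $\tfrac12\{X(x),\rho(x)\}=\dot\rho(x)$, defined on the range of $\sqrt{\rho(x)}$ and with $X(x)\sqrt{\rho(x)}$ bounded; $\mathrm{tr}(\rho X^2)$ means $\|X\sqrt\rho\|_{HS}^2$, and $F(x)=\infty$ if there is no such $X(x)$. Let $\varphi$ be a real random variable with $\mathbb E[\varphi]=0$, $\mathbb E[\varphi^2]<\infty$ and probability density $q$; let $\alpha$ be the outcome of a POVM $\Pi$ measured on $\rho(\varphi)$, i.e. conditionally on $\varphi=x$ the outcome has distribution $P_x(A)=\mathrm{tr}(\rho(x)\Pi(A))$;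 and let $\hat\varphi=\Phi(\alpha)$, for a measurable real function $\Phi$, satisfy $\mathbb E[\hat\varphi^2]<\infty$. Put $$\zeta=\frac{\mathbb E[(\varphi-\hat\varphi)\varphi]}{\mathbb E[\varphi^2]},\qquad \tilde F=\int_{\mathbb R} F(x)\,\frac{\tilde q(x)^2}{q(x)}\,dx,\qquad \tilde q(x)=\frac{\int_x^\infty (s-\mu(q))\,q(s)\,ds}{\sigma(q)^2},$$ where $\mu(q)$ and $\sigma(q)^2$ are the mean and the variance of $q$. Then $$\mathbb E[(\varphi-\hat\varphi)^2]\ \ge\ (1-\zeta)^2\,\frac1{\tilde F}+\zeta^2\,\mathbb E[\varphi^2].$$ If furthermore $\hat\varphi$ is an unbiased estimation, i.e. for every $x\in\mathbb R$ the function $\Phi$ is $P_x$-integrable with $\int\Phi\,dP_x=x$, and if $q$ is continuous and $F$ is locally bounded, then $$\mathbb E[(\varphi-\hat\varphi)^2]\ \ge\ (1-\zeta)^2\,\mathbb E\!\left[\frac1{F(\varphi)}\right]+\zeta^2\,\mathbb E[\varphi^2].$$ (In $[0,\infty]$: $1/\infty=0$, $1/0=\infty$, $0\cdot\infty=0$;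 in the integrand of $\tilde F$, $0/0=0$ and $c/0=\infty$ for $c>0$.) -/

import Mathlib

open MeasureTheory Filter Topology
open scoped InnerProductSpace ENNReal NNReal

namespace QuantumEstimation

noncomputable section

section Trace

variable {H : Type*} [NormedAddCommGroup H] [InnerProductSpace ℂ H] [CompleteSpace H]

/-- The index type of a fixed Hilbert basis of `H`. -/
def BasisIndex (H : Type*) [NormedAddCommGroup H] [InnerProductSpace ℂ H] [CompleteSpace H] :
    Set H :=
  (exists_hilbertBasis ℂ H).choose

/-- A fixed Hilbert basis of `H`. -/
def basis (H : Type*) [NormedAddCommGroup H] [InnerProductSpace ℂ H] [CompleteSpace H] :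
    HilbertBasis (BasisIndex H) ℂ H :=
  (exists_hilbertBasis ℂ H).choose_spec.choose

/-- The trace `∑ᵢ ⟨bᵢ, T bᵢ⟩` in the fixed Hilbert basis. For trace class operators, the only ones
to which it is applied below, the series converges absolutely and does not depend on the basis. -/
def trace (T : H →L[ℂ] H) : ℂ := ∑' i, ⟪basis H i, T (basis H i)⟫_ℂ

/-- A state on `H`: a positive operator of unit trace. -/
structure State (H : Type*) [NormedAddCommGroup H] [InnerProductSpace ℂ H] [CompleteSpace H] where
  op : H →L[ℂ] H
  pos : op.IsPositive
  trace_one : HasSum (fun i => ⟪basis H i, op (basis H i)⟫_ℂ) 1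

/-- The square root of a state. -/
def State.sqrt (ρ : State H) : H →L[ℂ] H := CFC.sqrt ρ.op

theorem State.sqrt_mul_sqrt (ρ : State H) : ρ.sqrt * ρ.sqrt = ρ.op :=
  CFC.sqrt_mul_sqrt_self ρ.op ((ContinuousLinearMap.nonneg_iff_isPositive ρ.op).2 ρ.pos)

theorem State.sqrt_pos (ρ : State H) : ρ.sqrt.IsPositive :=
  (ContinuousLinearMap.nonneg_iff_isPositive _).1 (CFC.sqrt_nonneg ρ.op)

theorem State.inner_sqrt (ρ : State H) (x y : H) :
    ⟪ρ.sqrt x, y⟫_ℂ = ⟪x, ρ.sqrt y⟫_ℂ := by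
  exact ρ.sqrt_pos.isSymmetric x y

theorem State.summable_norm_sqrt (ρ : State H) :
    Summable fun i => ‖ρ.sqrt (basis H i)‖ ^ 2 := by
  have h := (Complex.hasSum_re ρ.trace_one).summable
  refine h.congr fun i => ?_
  rw [← ρ.sqrt_mul_sqrt, mul_apply_eq_comp, ← ρ.inner_sqrt,
    inner_self_eq_norm_sq_to_K]
  norm_cast

/-- Cyclicity `tr (r r A) = tr (r A r)` for symmetric `r` with `∑ ‖r bᵢ‖² < ∞`, with convergence
of both series. -/
theorem hasSum_cyclic {ι : Type*} (b : HilbertBasis ι ℂ H) (r A A' : H →L[ℂ] H)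
    (hr : ∀ x y, ⟪r x, y⟫_ℂ = ⟪x, r y⟫_ℂ) (hA : ∀ x y, ⟪A' x, y⟫_ℂ = ⟪x, A y⟫_ℂ)
    (hs : Summable fun i => ‖r (b i)‖ ^ 2) :
    HasSum (fun j => ⟪r (b j), A (r (b j))⟫_ℂ) (∑' i, ⟪b i, r (r (A (b i)))⟫_ℂ) := by
  have hn : ∀ x : H, HasSum (fun i => ‖⟪x, b i⟫_ℂ‖ ^ 2) (‖x‖ ^ 2) := by
    intro x
    have h := Complex.hasSum_re (b.hasSum_inner_mul_inner x x)
    rw [inner_self_eq_norm_sq_to_K] at h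
    convert h using 1
    · funext i
      rw [← inner_conj_symm (b i) x, Complex.mul_conj, Complex.normSq_eq_norm_sq]
      norm_cast
    · norm_cast
  have hsB : ∀ B : H →L[ℂ] H, Summable fun p : ι × ι => ‖⟪B (r (b p.1)), b p.2⟫_ℂ‖ ^ 2 := by
    intro B
    refine (summable_prod_of_nonneg (f := fun p : ι × ι => ‖⟪B (r (b p.1)), b p.2⟫_ℂ‖ ^ 2)
      (fun p => sq_nonneg _)).2 ⟨fun j => (hn (B (r (b j)))).summable, ?_⟩
    have hj : ∀ j, ∑' i, ‖⟪B (r (b j)), b i⟫_ℂ‖ ^ 2 = ‖B (r (b j))‖ ^ 2 :=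
      fun j => (hn (B (r (b j)))).tsum_eq
    simp only [hj]
    refine Summable.of_nonneg_of_le (fun j => sq_nonneg _) (fun j => ?_)
      (hs.mul_left (‖B‖ ^ 2))
    rw [← mul_pow]
    exact pow_le_pow_left₀ (norm_nonneg _) (B.le_opNorm _) 2
  have hg : Summable fun p : ι × ι =>
      ⟪A' (r (b p.1)), b p.2⟫_ℂ * ⟪b p.2, r (b p.1)⟫_ℂ := by
    refine Summable.of_norm_bounded ((hsB A').add (hsB 1)) fun p => ?_
    have h2 : ‖⟪b p.2, r (b p.1)⟫_ℂ‖ = ‖⟪(1 : H →L[ℂ] H) (r (b p.1)), b p.2⟫_ℂ‖ := by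
      rw [norm_inner_symm]; rfl
    rw [norm_mul, h2]
    generalize ‖⟪A' (r (b p.1)), b p.2⟫_ℂ‖ = s
    generalize ‖⟪(1 : H →L[ℂ] H) (r (b p.1)), b p.2⟫_ℂ‖ = t
    nlinarith [sq_nonneg (s - t), sq_nonneg (s + t)]
  have e1 := hg.hasSum.prod_fiberwise (g := fun j => ⟪r (b j), A (r (b j))⟫_ℂ) (fun j => by
    have := b.hasSum_inner_mul_inner (A' (r (b j))) (r (b j))
    rwa [hA] at this)
  have e2 := ((Equiv.prodComm ι ι).hasSum_iff.2 hg.hasSum).prod_fiberwise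
    (g := fun i => ⟪b i, r (r (A (b i)))⟫_ℂ) (fun i => by
      have := b.hasSum_inner_mul_inner (r (b i)) (r (A (b i)))
      rw [hr] at this
      have e : (fun j => ⟪r (b i), b j⟫_ℂ * ⟪b j, r (A (b i))⟫_ℂ) =
          fun j => ⟪A' (r (b j)), b i⟫_ℂ * ⟪b i, r (b j)⟫_ℂ := by
        funext j
        rw [hA, hr, hr, mul_comm]
      rw [e] at this
      exact this)
  rw [e2.tsum_eq]
  exact e1

/-- Cyclicity of the trace: `tr (ρ A) = tr (√ρ A √ρ)`. -/
theorem State.hasSum_sqrt (ρ : State H) (A : H →L[ℂ] H) :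
    HasSum (fun j => ⟪ρ.sqrt (basis H j), A (ρ.sqrt (basis H j))⟫_ℂ) (trace (ρ.op * A)) := by
  have h := hasSum_cyclic (basis H) ρ.sqrt A (ContinuousLinearMap.adjoint A) ρ.inner_sqrt
    (fun x y => ContinuousLinearMap.adjoint_inner_left A y x) ρ.summable_norm_sqrt
  unfold trace
  rw [← ρ.sqrt_mul_sqrt]
  exact h

end Trace

section Measurement

variable {H : Type*} [NormedAddCommGroup H] [InnerProductSpace ℂ H] [CompleteSpace H]
variable {M : Type*} [MeasurableSpace M]

/-- A POVM on `H` with outcomes in the measurable space `M`: a weakly countably additive map from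
measurable sets to positive operators with total mass `1`. A family `Π(α) ≥ 0` with
`∫ Π(α) dα = 1` gives `A ↦ ∫_A Π(α) dα`. -/
structure POVM (M : Type*) [MeasurableSpace M]
    (H : Type*) [NormedAddCommGroup H] [InnerProductSpace ℂ H] [CompleteSpace H] where
  op : Set M → H →L[ℂ] H
  pos : ∀ A, MeasurableSet A → (op A).IsPositive
  univ : op Set.univ = 1
  hasSum_iUnion : ∀ f : ℕ → Set M, (∀ n, MeasurableSet (f n)) →
    Pairwise (Function.onFun Disjoint f) →
    ∀ x y : H, HasSum (fun n => ⟪x, op (f n) y⟫_ℂ) ⟪x, op (⋃ n, f n) y⟫_ℂ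

theorem POVM.inner_empty (E : POVM M H) (x y : H) : ⟪x, E.op ∅ y⟫_ℂ = 0 := by
  have h := E.hasSum_iUnion (fun _ => ∅) (fun _ => MeasurableSet.empty)
    (fun _ _ _ => disjoint_bot_left) x y
  exact (summable_const_iff _).1 h.summable

theorem ofReal_trace_eq (ρ : State H) (E : POVM M H) {A : Set M} (hA : MeasurableSet A) :
    ENNReal.ofReal (trace (ρ.op * E.op A)).re =
      ∑' j, ENNReal.ofReal
        (⟪ρ.sqrt (basis H j), E.op A (ρ.sqrt (basis H j))⟫_ℂ).re := by
  have h := Complex.hasSum_re (ρ.hasSum_sqrt (E.op A))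
  rw [← h.tsum_eq, ENNReal.ofReal_tsum_of_nonneg _ h.summable]
  intro j
  exact (E.pos A hA).re_inner_nonneg_right _

/-- The distribution of the measurement outcome in the state `ρ`, given by the Born rule
`A ↦ tr (ρ E(A))`. -/
def outcomeLaw (ρ : State H) (E : POVM M H) : Measure M :=
  Measure.ofMeasurable (fun A _ => ENNReal.ofReal (trace (ρ.op * E.op A)).re)
    (by
      rw [ofReal_trace_eq ρ E MeasurableSet.empty]
      simp [E.inner_empty])
    (by
      intro f hf hd
      simp only [ofReal_trace_eq ρ E (MeasurableSet.iUnion hf), fun n => ofReal_trace_eq ρ E (hf n)]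
      rw [ENNReal.tsum_comm]
      refine tsum_congr fun j => ?_
      have h := Complex.hasSum_re (E.hasSum_iUnion f hf hd (ρ.sqrt (basis H j))
        (ρ.sqrt (basis H j)))
      rw [← h.tsum_eq, ENNReal.ofReal_tsum_of_nonneg _ h.summable]
      intro n
      exact (E.pos _ (hf n)).re_inner_nonneg_right _)

theorem outcomeLaw_apply (ρ : State H) (E : POVM M H) {A : Set M} (hA : MeasurableSet A) :
    outcomeLaw ρ E A = ENNReal.ofReal (trace (ρ.op * E.op A)).re :=
  Measure.ofMeasurable_apply A hA

/-- The random variable `φ` has density `q` and, given `φ = x`, the random variable `α` is the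
outcome of the measurement `E` on the state `ρ x`. -/
def IsMeasuredParameter {Ω : Type*} [MeasurableSpace Ω] (μ : Measure Ω) (φ : Ω → ℝ) (α : Ω → M)
    (q : ℝ → ℝ) (ρ : ℝ → State H) (E : POVM M H) : Prop :=
  ∀ (B : Set ℝ) (A : Set M), MeasurableSet B → MeasurableSet A →
    μ (φ ⁻¹' B ∩ α ⁻¹' A) = ∫⁻ x in B, ENNReal.ofReal (q x) * outcomeLaw (ρ x) E A

/-- The estimation strategy `(E, Φ)` is unbiased for the family `ρ`: for every value of the
parameter the conditional expectation of the estimate is that value. -/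
def IsUnbiased (ρ : ℝ → State H) (E : POVM M H) (Φ : M → ℝ) : Prop :=
  ∀ x : ℝ, Integrable Φ (outcomeLaw (ρ x) E) ∧ ∫ a, Φ a ∂(outcomeLaw (ρ x) E) = x

end Measurement

section Fisher

variable {H : Type*} [NormedAddCommGroup H] [InnerProductSpace ℂ H] [CompleteSpace H]

/-- The family of states `ρ` is continuously differentiable with derivative `ρ'`, tested against
all bounded operators. Continuous differentiability in trace norm implies this. -/
structure IsContDiffFamily (ρ : ℝ → State H) (ρ' : ℝ → H →L[ℂ] H) : Prop where
  hasDerivAt : ∀ (A : H →L[ℂ] H) (x : ℝ),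
    HasDerivAt (fun y => trace ((ρ y).op * A)) (trace (ρ' x * A)) x
  continuous : ∀ A : H →L[ℂ] H, Continuous fun x => trace (ρ' x * A)

/-- A symmetric logarithmic derivative of the state `ρ` in the direction `D`: a solution `X` of
`½ (X ρ + ρ X) = D`. In infinite dimensions `X` may be unbounded; it is a symmetric operator whose
domain contains the range of `√ρ`, and `Y = X √ρ` is bounded, so that `X ρ = Y √ρ` is bounded and
`ρ X` is read as the adjoint of `X ρ`. -/
structure SLD (ρ : State H) (D : H →L[ℂ] H) where
  X : H →ₗ.[ℂ] H
  symm : ∀ u v : X.domain, ⟪X u, (v : H)⟫_ℂ = ⟪(u : H), X v⟫_ℂ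
  sqrt_mem : ∀ u, ρ.sqrt u ∈ X.domain
  Y : H →L[ℂ] H
  Y_eq : ∀ u, Y u = X ⟨ρ.sqrt u, sqrt_mem u⟩
  anticommutator : (1 / 2 : ℂ) • (Y * ρ.sqrt + ContinuousLinearMap.adjoint (Y * ρ.sqrt)) = D

/-- The quantum Fisher information `tr (ρ X²) = tr ((X √ρ)* (X √ρ)) = ∑ᵢ ‖X √ρ bᵢ‖²`, where `X` is
a symmetric logarithmic derivative. The value is the same for all `X`, so that the infimum only
gives the value `∞` when there is no `X`. -/
def quantumFisher (ρ : State H) (D : H →L[ℂ] H) : ℝ≥0∞ :=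
  ⨅ L : SLD ρ D, ∑' i, ENNReal.ofReal (‖L.Y (basis H i)‖ ^ 2)

/-- The mean of a probability density. -/
def densityMean (q : ℝ → ℝ) : ℝ := ∫ s, s * q s

/-- The variance of a probability density. -/
def densityVar (q : ℝ → ℝ) : ℝ := ∫ s, (s - densityMean q) ^ 2 * q s

/-- The function `q̃(x) = σ(q)⁻² ∫_x^∞ (s - μ(q)) q(s) ds`. -/
def qTilde (q : ℝ → ℝ) (x : ℝ) : ℝ :=
  (∫ s in Set.Ioi x, (s - densityMean q) * q s) / densityVar q

/-- The average Fisher information `∫ F(x) q̃(x)² / q(x) dx`, with the conventions `0 / 0 = 0`,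
`c / 0 = ∞` for `c > 0`, and `0 * ∞ = 0`. -/
def averageFisher (F : ℝ → ℝ≥0∞) (q : ℝ → ℝ) : ℝ≥0∞ :=
  ∫⁻ x, F x * (ENNReal.ofReal (qTilde q x ^ 2) / ENNReal.ofReal (q x))

end Fisher

end

end QuantumEstimation

open QuantumEstimation

namespace QuantumEstimation

/-! ### Hilbert–Schmidt pairings and the trace of the derivative -/

section HilbertSchmidt

variable {H : Type*} [NormedAddCommGroup H] [InnerProductSpace ℂ H]

/-! Let `d s x` be the derivative at `x` of the expectation of a simple function `s` of the outcome.
Everything rests on the Cauchy–Schwarz inequality `(d s x)² ≤ F(x) E_x[s²]`, for finite `F(x)`.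
Since the derivative of the state is `½ (Y √ρ + √ρ Y*)` with `Y = X √ρ`, the number `d s x` is the
real part of a Hilbert–Schmidt pairing of `√ρ` with `Y`, weighted by the POVM; positivity of the
POVM elements makes the corresponding quadratic polynomial nonnegative (`SLD.scoreSum_sq_le`).
Constants have derivative zero, so `s` may be centred at any number, even one depending on `x`.
`IsScoreBound` records these facts for a Markov kernel; what remains is classical.

For the first bound, integration by parts turns `∫ q̃ · d s` into `E[φ s(α)] / E[φ²]`. A second
Cauchy–Schwarz inequality, separating `F q̃² / q` from `q`, bounds its square by `F̃ · E[(s(α) -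
cφ)²]`, and approximation replaces `s` by `Φ` (`IsJointLaw.sq_corr_le`). For `c = 1 - ζ` the
residual `Φ(α) - cφ` is orthogonal to `φ`, and Pythagoras splits the error into the residual and `ζ²
E[φ²]`.

For an unbiased estimate `ζ = 0`. Locally where `q > 0`, the scores of simple approximations of `Φ`
converge a.e. to a function whose integral over `[a, x]` is `x - a`, hence to `1`. In the limit `1 ≤
F(x) E_x[(Φ - x)²]` (`IsScoreBound.ae_one_le_mul`), and `1 / F` is then integrated over the law of
`φ`. -/

theorem hasSum_norm_inner_sq {ι : Type*} (b : HilbertBasis ι ℂ H) (x : H) :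
    HasSum (fun i => ‖⟪b i, x⟫_ℂ‖ ^ 2) (‖x‖ ^ 2) := by
  have h := Complex.hasSum_re (b.hasSum_inner_mul_inner x x)
  rw [inner_self_eq_norm_sq_to_K] at h
  convert h using 1
  · funext i
    rw [← inner_conj_symm x (b i), mul_comm, Complex.mul_conj, Complex.normSq_eq_norm_sq]
    norm_cast
  · norm_cast

theorem summable_norm_inner_sq {ι : Type*} (b : HilbertBasis ι ℂ H) (S : H →L[ℂ] H)
    (hS : Summable fun j => ‖S (b j)‖ ^ 2) :
    Summable fun p : ι × ι => ‖⟪b p.2, S (b p.1)⟫_ℂ‖ ^ 2 := by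
  refine (summable_prod_of_nonneg (f := fun p : ι × ι => ‖⟪b p.2, S (b p.1)⟫_ℂ‖ ^ 2)
    (fun p => sq_nonneg _)).2 ⟨fun j => (hasSum_norm_inner_sq b (S (b j))).summable, ?_⟩
  simpa only [(hasSum_norm_inner_sq b (S (b _))).tsum_eq] using hS

theorem summable_norm_mul_sq {ι : Type*} (b : HilbertBasis ι ℂ H) (A S : H →L[ℂ] H)
    (hS : Summable fun j => ‖S (b j)‖ ^ 2) : Summable fun j => ‖(A * S) (b j)‖ ^ 2 := by
  refine Summable.of_nonneg_of_le (fun j => sq_nonneg _) (fun j => ?_) (hS.mul_left (‖A‖ ^ 2))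
  rw [← mul_pow]
  exact pow_le_pow_left₀ (norm_nonneg _) (A.le_opNorm _) 2

variable [CompleteSpace H]

/-- Cyclicity `tr (S T*) = tr (T* S)` for Hilbert–Schmidt operators. -/
theorem hasSum_inner_mul_adjoint {ι : Type*} (b : HilbertBasis ι ℂ H) (S T T' : H →L[ℂ] H)
    (hT : ∀ x y, ⟪T x, y⟫_ℂ = ⟪x, T' y⟫_ℂ)
    (hsS : Summable fun j => ‖S (b j)‖ ^ 2) (hsT : Summable fun j => ‖T (b j)‖ ^ 2) :
    ∃ c, HasSum (fun j => ⟪T (b j), S (b j)⟫_ℂ) c ∧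
      HasSum (fun i => ⟪b i, S (T' (b i))⟫_ℂ) c := by
  -- Both traces are iterated sums of this absolutely convergent double series, taken in the two
  -- orders.
  have hg : Summable fun p : ι × ι => ⟪T (b p.1), b p.2⟫_ℂ * ⟪b p.2, S (b p.1)⟫_ℂ := by
    refine Summable.of_norm_bounded
      ((summable_norm_inner_sq b T hsT).add (summable_norm_inner_sq b S hsS)) fun p => ?_
    rw [norm_mul, norm_inner_symm (T (b p.1))]
    nlinarith [sq_nonneg (‖⟪b p.2, T (b p.1)⟫_ℂ‖ - ‖⟪b p.2, S (b p.1)⟫_ℂ‖),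
      norm_nonneg ⟪b p.2, T (b p.1)⟫_ℂ, norm_nonneg ⟪b p.2, S (b p.1)⟫_ℂ]
  refine ⟨_, hg.hasSum.prod_fiberwise fun j => b.hasSum_inner_mul_inner (T (b j)) (S (b j)),
    ((Equiv.prodComm ι ι).hasSum_iff.2 hg.hasSum).prod_fiberwise fun i => ?_⟩
  have h := b.hasSum_inner_mul_inner (ContinuousLinearMap.adjoint S (b i)) (T' (b i))
  rw [ContinuousLinearMap.adjoint_inner_left] at h
  have e : (fun j => ⟪ContinuousLinearMap.adjoint S (b i), b j⟫_ℂ * ⟪b j, T' (b i)⟫_ℂ) =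
      fun j => ⟪T (b j), b i⟫_ℂ * ⟪b i, S (b j)⟫_ℂ := by
    funext j
    rw [ContinuousLinearMap.adjoint_inner_left, mul_comm, ← hT]
  rw [e] at h
  exact h

/-- `Re tr (D A) = Re tr (√ρ A Y)` for self-adjoint `A` and `D = ½ (Y √ρ + √ρ Y*)`. -/
theorem SLD.hasSum_re_trace {ρ : State H} {D : H →L[ℂ] H} (L : SLD ρ D)
    (hL : Summable fun j => ‖L.Y (basis H j)‖ ^ 2) (A : H →L[ℂ] H) (hA : A.IsPositive) :
    HasSum (fun j => (⟪ρ.sqrt (basis H j), A (L.Y (basis H j))⟫_ℂ).re) (trace (D * A)).re := by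
  have hsym : ∀ x y, ⟪A x, y⟫_ℂ = ⟪x, A y⟫_ℂ := hA.inner_left_eq_inner_right
  obtain ⟨c₁, h₁, h₁'⟩ := hasSum_inner_mul_adjoint (basis H) L.Y (A * ρ.sqrt) (ρ.sqrt * A)
    (fun x y => by simp only [mul_apply_eq_comp, hsym, ρ.inner_sqrt]) hL
    (summable_norm_mul_sq _ A _ ρ.summable_norm_sqrt)
  obtain ⟨c₂, h₂, h₂'⟩ := hasSum_inner_mul_adjoint (basis H) ρ.sqrt (A * L.Y)
    (ContinuousLinearMap.adjoint L.Y * A)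
    (fun x y => by simp only [mul_apply_eq_comp, hsym,
      ContinuousLinearMap.adjoint_inner_right]) ρ.summable_norm_sqrt
    (summable_norm_mul_sq _ A _ hL)
  -- The two halves of the anticommutator contribute complex conjugate traces.
  have hc : c₂.re = c₁.re := by
    refine (Complex.hasSum_re h₂).unique ?_
    convert Complex.hasSum_re h₁ using 2 with j
    rw [← inner_conj_symm, Complex.conj_re, mul_apply_eq_comp, mul_apply_eq_comp, hsym]
  have htr : trace (D * A) = (1 / 2 : ℂ) * (c₁ + c₂) := by
    unfold trace
    refine (HasSum.mul_left (1 / 2 : ℂ) (h₁'.add h₂')).tsum_eq ▸ tsum_congr fun i => ?_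
    rw [← inner_add_right, ← inner_smul_right, mul_apply_eq_comp,
      ← DFunLike.congr_fun L.anticommutator, smul_apply, add_apply]
    congr 3
    refine ext_inner_left ℂ fun v => ?_
    rw [ContinuousLinearMap.adjoint_inner_right, mul_apply_eq_comp, ← ρ.inner_sqrt,
      mul_apply_eq_comp, ContinuousLinearMap.adjoint_inner_right]
  have hre : (trace (D * A)).re = c₁.re := by
    rw [htr]
    have : ((1 / 2 : ℂ) * (c₁ + c₂)).re = 1 / 2 * (c₁.re + c₂.re) := by
      simp [Complex.mul_re]
    rw [this, hc]; ring
  rw [hre]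
  convert Complex.hasSum_re h₁ using 2 with j
  rw [mul_apply_eq_comp, hsym]

end HilbertSchmidt

/-! ### The score of a measurement and the quantum Fisher information -/

section Score

variable {H : Type*} [NormedAddCommGroup H] [InnerProductSpace ℂ H] [CompleteSpace H]
variable {M : Type*} [MeasurableSpace M]

theorem POVM.re_inner_nonneg (E : POVM M H) {A : Set M} (hA : MeasurableSet A) (x : H) :
    0 ≤ (⟪x, E.op A x⟫_ℂ).re :=
  (E.pos A hA).re_inner_nonneg_right x

/-- The measure `A ↦ ⟨y, E(A) y⟩`. -/
noncomputable def POVM.vectorLaw (E : POVM M H) (y : H) : Measure M :=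
  Measure.ofMeasurable (fun A _ => ENNReal.ofReal (⟪y, E.op A y⟫_ℂ).re)
    (by simp [E.inner_empty])
    (by
      intro f hf hd
      have h := Complex.hasSum_re (E.hasSum_iUnion f hf hd y y)
      rw [← h.tsum_eq, ENNReal.ofReal_tsum_of_nonneg (fun n => E.re_inner_nonneg (hf n) y)
        h.summable])

theorem POVM.sum_re_inner (E : POVM M H) (s : SimpleFunc M ℝ) (y : H) :
    ∑ c ∈ s.range, (⟪y, E.op (s ⁻¹' {c}) y⟫_ℂ).re = ‖y‖ ^ 2 := by
  have happ : ∀ A, MeasurableSet A →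
      E.vectorLaw y A = ENNReal.ofReal (⟪y, E.op A y⟫_ℂ).re :=
    fun A hA => Measure.ofMeasurable_apply A hA
  -- The fibres of `s` partition the outcome space, whose total mass is given by `E.univ`.
  have h : ∑ c ∈ s.range, E.vectorLaw y (s ⁻¹' {c}) = E.vectorLaw y Set.univ := by
    have h := SimpleFunc.map_lintegral (fun _ : ℝ => (1 : ℝ≥0∞)) s (μ := E.vectorLaw y)
    rw [← SimpleFunc.lintegral_eq_lintegral] at h
    simpa [Function.comp_def] using h.symm
  simp only [happ _ (s.measurableSet_fiber _)] at h
  rw [happ _ MeasurableSet.univ, E.univ, ← ENNReal.ofReal_sum_of_nonneg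
    (fun c _ => E.re_inner_nonneg (s.measurableSet_fiber c) y)] at h
  have h1 : (⟪y, (1 : H →L[ℂ] H) y⟫_ℂ).re = ‖y‖ ^ 2 := by
    rw [one_apply_eq_self, inner_self_eq_norm_sq_to_K]; norm_cast
  rw [h1] at h
  exact (ENNReal.ofReal_eq_ofReal_iff
    (Finset.sum_nonneg fun c _ => E.re_inner_nonneg (s.measurableSet_fiber c) y)
    (sq_nonneg _)).1 h

theorem outcomeLaw_real (ρ : State H) (E : POVM M H) {A : Set M} (hA : MeasurableSet A) :
    HasSum (fun j => (⟪ρ.sqrt (basis H j), E.op A (ρ.sqrt (basis H j))⟫_ℂ).re)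
      ((outcomeLaw ρ E).real A) := by
  have h := Complex.hasSum_re (ρ.hasSum_sqrt (E.op A))
  rwa [Measure.real, outcomeLaw_apply ρ E hA, ENNReal.toReal_ofReal
    (h.nonneg fun j => E.re_inner_nonneg hA _)]

theorem outcomeLaw_real_eq (ρ : State H) (E : POVM M H) {A : Set M} (hA : MeasurableSet A) :
    (outcomeLaw ρ E).real A = (trace (ρ.op * E.op A)).re :=
  (outcomeLaw_real ρ E hA).unique (Complex.hasSum_re (ρ.hasSum_sqrt (E.op A)))

instance isProbabilityMeasure_outcomeLaw (ρ : State H) (E : POVM M H) :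
    IsProbabilityMeasure (outcomeLaw ρ E) := by
  constructor
  rw [outcomeLaw_apply ρ E MeasurableSet.univ, E.univ, mul_one, trace, ρ.trace_one.tsum_eq]
  simp

/-- The derivative of the expectation of the simple function `s` of the outcome. -/
noncomputable def scoreSum (D : H →L[ℂ] H) (E : POVM M H) (s : SimpleFunc M ℝ) : ℝ :=
  ∑ c ∈ s.range, c * (trace (D * E.op (s ⁻¹' {c}))).re

/-- Cauchy–Schwarz for the positive semidefinite form `∑_c ⟨·, E(s = c) ·⟩`, summed over the basis,
between the vectors `c √ρ bⱼ` and `Y bⱼ`. -/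
theorem SLD.scoreSum_sq_le {ρ : State H} {D : H →L[ℂ] H} (L : SLD ρ D)
    (hL : Summable fun j => ‖L.Y (basis H j)‖ ^ 2) (E : POVM M H) (s : SimpleFunc M ℝ) :
    scoreSum D E s ^ 2 ≤ (∑' j, ‖L.Y (basis H j)‖ ^ 2) *
      ∑ c ∈ s.range, c ^ 2 * (outcomeLaw ρ E).real (s ⁻¹' {c}) := by
  set Q := ∑' j, ‖L.Y (basis H j)‖ ^ 2
  set P := ∑ c ∈ s.range, c ^ 2 * (outcomeLaw ρ E).real (s ⁻¹' {c})
  have hm := fun c => s.measurableSet_fiber c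
  have hP : HasSum (fun j => ∑ c ∈ s.range,
      c ^ 2 * (⟪ρ.sqrt (basis H j), E.op (s ⁻¹' {c}) (ρ.sqrt (basis H j))⟫_ℂ).re) P :=
    hasSum_sum fun c _ => (outcomeLaw_real ρ E (hm c)).mul_left _
  have hd : HasSum (fun j => ∑ c ∈ s.range,
      c * (⟪ρ.sqrt (basis H j), E.op (s ⁻¹' {c}) (L.Y (basis H j))⟫_ℂ).re) (scoreSum D E s) :=
    hasSum_sum fun c _ => (L.hasSum_re_trace hL _ (E.pos _ (hm c))).mul_left _
  have hQ : HasSum (fun j => ∑ c ∈ s.range,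
      (⟪L.Y (basis H j), E.op (s ⁻¹' {c}) (L.Y (basis H j))⟫_ℂ).re) Q := by
    simpa only [E.sum_re_inner] using hL.hasSum
  have key : ∀ t : ℝ, 0 ≤ P * (t * t) + (-2 * scoreSum D E s) * t + Q := by
    intro t
    refine HasSum.nonneg (fun j => ?_) (((hP.mul_right (t * t)).add
      ((hd.mul_left (-2)).mul_right t)).add hQ)
    rw [Finset.sum_mul, Finset.mul_sum, Finset.sum_mul, ← Finset.sum_add_distrib,
      ← Finset.sum_add_distrib]
    refine Finset.sum_nonneg fun c _ => ?_
    -- Expanding this square and summing over `c` and `j` gives the polynomial `P t² - 2 d t + Q`.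
    have h0 := E.re_inner_nonneg (hm c)
      (((t * c : ℝ) : ℂ) • ρ.sqrt (basis H j) - L.Y (basis H j))
    have hs : (⟪L.Y (basis H j), E.op (s ⁻¹' {c}) (ρ.sqrt (basis H j))⟫_ℂ).re =
        (⟪ρ.sqrt (basis H j), E.op (s ⁻¹' {c}) (L.Y (basis H j))⟫_ℂ).re := by
      rw [← (E.pos _ (hm c)).inner_left_eq_inner_right, ← inner_conj_symm, Complex.conj_re]
    simp only [map_sub, map_smul, inner_sub_left, inner_sub_right, inner_smul_left,
      inner_smul_right, Complex.conj_ofReal, Complex.sub_re, Complex.re_ofReal_mul, hs] at h0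
    linarith
  have := discrim_le_zero key
  rw [discrim] at this
  linarith

theorem lintegral_ofReal_sq_simpleFunc (P : Measure M) [IsProbabilityMeasure P]
    (s : SimpleFunc M ℝ) :
    ∫⁻ a, ENNReal.ofReal (s a ^ 2) ∂P =
      ENNReal.ofReal (∑ c ∈ s.range, c ^ 2 * P.real (s ⁻¹' {c})) := by
  have h := SimpleFunc.map_lintegral (fun c : ℝ => ENNReal.ofReal (c ^ 2)) s (μ := P)
  rw [← SimpleFunc.lintegral_eq_lintegral] at h
  simp only [SimpleFunc.coe_map, Function.comp] at h
  rw [h, ENNReal.ofReal_sum_of_nonneg (fun c _ => by positivity)]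
  refine Finset.sum_congr rfl fun c _ => ?_
  rw [ENNReal.ofReal_mul (sq_nonneg _), ofReal_measureReal]

theorem scoreSum_sq_div_le (ρ : State H) (D : H →L[ℂ] H) (E : POVM M H) (s : SimpleFunc M ℝ) :
    ENNReal.ofReal (scoreSum D E s ^ 2) / ∫⁻ a, ENNReal.ofReal (s a ^ 2) ∂(outcomeLaw ρ E)
      ≤ quantumFisher ρ D := by
  refine le_iInf fun L => ?_
  by_cases hL : Summable fun j => ‖L.Y (basis H j)‖ ^ 2
  · refine ENNReal.div_le_of_le_mul ?_
    rw [lintegral_ofReal_sq_simpleFunc, ← ENNReal.ofReal_tsum_of_nonneg (fun _ => sq_nonneg _) hL,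
      ← ENNReal.ofReal_mul (tsum_nonneg fun _ => sq_nonneg _)]
    exact ENNReal.ofReal_le_ofReal (L.scoreSum_sq_le hL E s)
  -- If `Y` is not Hilbert–Schmidt, its term in the infimum is `∞`.
  · refine le_top.trans_eq (Eq.symm (by_contra fun h => hL ?_))
    simpa only [ENNReal.toReal_ofReal (sq_nonneg _)] using ENNReal.summable_toReal h

theorem hasDerivAt_integral_simpleFunc {ρ : ℝ → State H} {ρ' : ℝ → H →L[ℂ] H}
    (hρ : IsContDiffFamily ρ ρ') (E : POVM M H) (s : SimpleFunc M ℝ) (x : ℝ) :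
    HasDerivAt (fun y => ∫ a, s a ∂(outcomeLaw (ρ y) E)) (scoreSum (ρ' x) E s) x := by
  have h : ∀ y, ∫ a, s a ∂(outcomeLaw (ρ y) E) =
      ∑ c ∈ s.range, c * (trace ((ρ y).op * E.op (s ⁻¹' {c}))).re := by
    intro y
    rw [SimpleFunc.integral_eq_sum _ (SimpleFunc.integrable_of_isFiniteMeasure s)]
    refine Finset.sum_congr rfl fun c _ => ?_
    rw [outcomeLaw_real_eq _ _ (s.measurableSet_fiber c), smul_eq_mul, mul_comm]
  simp only [h]
  refine HasDerivAt.fun_sum fun c _ => HasDerivAt.const_mul c ?_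
  exact Complex.reCLM.hasFDerivAt.comp_hasDerivAt x (hρ.hasDerivAt _ x)

theorem continuous_scoreSum {ρ : ℝ → State H} {ρ' : ℝ → H →L[ℂ] H}
    (hρ : IsContDiffFamily ρ ρ') (E : POVM M H) (s : SimpleFunc M ℝ) :
    Continuous fun x => scoreSum (ρ' x) E s :=
  continuous_finsetSum _ fun _ _ =>
    continuous_const.mul (Complex.continuous_re.comp (hρ.continuous _))

theorem measurable_outcomeLaw {ρ : ℝ → State H} {ρ' : ℝ → H →L[ℂ] H}
    (hρ : IsContDiffFamily ρ ρ') (E : POVM M H) :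
    Measurable fun x => outcomeLaw (ρ x) E := by
  refine Measure.measurable_of_measurable_coe _ fun A hA => ?_
  simp only [outcomeLaw_apply _ E hA]
  refine (ENNReal.continuous_ofReal.comp (Complex.continuous_re.comp ?_)).measurable
  exact continuous_iff_continuousAt.2 fun x => (hρ.hasDerivAt _ x).continuousAt

end Score

/-! ### Tail integrals, Cauchy–Schwarz and differentiation of primitives -/

section Calculus

theorem setIntegral_Ioi_eq_sub {h : ℝ → ℝ} (hh : Integrable h) (x : ℝ) :
    ∫ s in Set.Ioi x, h s = (∫ s in Set.Ioi 0, h s) - ∫ s in (0 : ℝ)..x, h s := by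
  rw [← intervalIntegral.integral_Ioi_sub_Ioi' hh.integrableOn hh.integrableOn]
  ring

theorem tendsto_setIntegral_Ioi_atTop {h : ℝ → ℝ} (hh : Integrable h) :
    Tendsto (fun x => ∫ s in Set.Ioi x, h s) atTop (𝓝 0) := by
  have h1 := intervalIntegral_tendsto_integral_Ioi 0 hh.integrableOn tendsto_id
  have h2 := h1.const_sub (∫ s in Set.Ioi 0, h s)
  rw [sub_self] at h2
  exact h2.congr fun x => (setIntegral_Ioi_eq_sub hh x).symm

theorem tendsto_setIntegral_Ioi_atBot {h : ℝ → ℝ} (hh : Integrable h) :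
    Tendsto (fun x => ∫ s in Set.Ioi x, h s) atBot (𝓝 (∫ s, h s)) := by
  have h1 := intervalIntegral_tendsto_integral_Iic 0 hh.integrableOn tendsto_id
  rw [← intervalIntegral.integral_Iic_add_Ioi (b := 0) hh.integrableOn hh.integrableOn]
  refine (h1.add_const (∫ s in Set.Ioi 0, h s)).congr fun x => ?_
  rw [id, setIntegral_Ioi_eq_sub hh x, intervalIntegral.integral_symm 0 x]
  ring

/-- Integration by parts against a tail integral. -/
theorem integral_tail_mul_deriv {h m m' : ℝ → ℝ} (hh : Integrable h) (h0 : ∫ s, h s = 0)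
    (hm : ∀ x, HasDerivAt m (m' x) x) (hm' : Continuous m') {C : ℝ} (hC : ∀ x, ‖m x‖ ≤ C)
    (hint : Integrable fun x => (∫ s in Set.Ioi x, h s) * m' x) :
    ∫ x, (∫ s in Set.Ioi x, h s) * m' x = ∫ x, h x * m x := by
  set G : ℝ → ℝ := fun x => ∫ s in Set.Ioi x, h s with hG
  have hderiv : deriv m = m' := funext fun x => (hm x).deriv
  have hm1 : ContDiff ℝ 1 m :=
    contDiff_one_iff_deriv.2 ⟨fun x => (hm x).differentiableAt, hderiv ▸ hm'⟩
  -- Since `h` is merely integrable, `G` is only absolutely continuous: its derivative comes from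
  -- Lebesgue differentiation.
  have hGae : ∀ᵐ x, deriv G x = -h x := by
    filter_upwards [_root_.LocallyIntegrable.ae_hasDerivAt_integral hh.locallyIntegrable] with x hx
    have := (hx 0).const_sub (∫ s in Set.Ioi 0, h s)
    rw [← this.deriv]
    congr 1
    funext y
    exact setIntegral_Ioi_eq_sub hh y
  have hparts : ∀ n : ℝ, 0 ≤ n → ∫ x in (-n)..n, G x * m' x =
      G n * m n - G (-n) * m (-n) + ∫ x in (-n)..n, h x * m x := by
    intro n hn
    have hac : AbsolutelyContinuousOnInterval G (-n) n := by
      have h1 := (hh.intervalIntegrable (a := -n) (b := n)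
        ).absolutelyContinuousOnInterval_intervalIntegral (c := 0)
        (Set.mem_uIcc.2 (Or.inl ⟨by linarith, hn⟩))
      have h2 : AbsolutelyContinuousOnInterval (fun _ : ℝ => ∫ s in Set.Ioi 0, h s) (-n) n :=
        contDiff_const.contDiffOn.absolutelyContinuousOnInterval
      rw [hG, funext (setIntegral_Ioi_eq_sub hh)]
      exact h2.fun_sub h1
    have h3 := hac.integral_mul_deriv_eq_deriv_mul
      hm1.contDiffOn.absolutelyContinuousOnInterval
    rw [hderiv] at h3
    rw [h3, sub_eq_add_neg _ (∫ x in (-n)..n, deriv G x * m x), ← intervalIntegral.integral_neg]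
    congr 1
    refine intervalIntegral.integral_congr_ae ?_
    filter_upwards [hGae] with x hx _
    rw [hx]; ring
  have hhm : Integrable fun x => h x * m x :=
    hh.mul_bdd hm1.continuous.aestronglyMeasurable (ae_of_all _ hC)
  -- The boundary terms vanish because `m` is bounded and `G` tends to `0` at both ends, at `-∞`
  -- thanks to `h0`.
  have hbdd : ∀ {l : Filter ℝ} {u : ℝ → ℝ}, Tendsto (fun n => G (u n)) l (𝓝 0) →
      Tendsto (fun n => G (u n) * m (u n)) l (𝓝 0) := by
    intro l u hu
    refine squeeze_zero_norm (fun n => ?_) (by simpa using hu.norm.mul_const C)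
    rw [norm_mul]
    exact mul_le_mul_of_nonneg_left (hC _) (norm_nonneg _)
  have hbot : Tendsto (fun n => G (-n)) atTop (𝓝 0) := by
    have := (tendsto_setIntegral_Ioi_atBot hh).comp tendsto_neg_atTop_atBot
    rwa [h0] at this
  have hL := intervalIntegral_tendsto_integral hint tendsto_neg_atTop_atBot tendsto_id
  have hR := ((hbdd (u := id) (tendsto_setIntegral_Ioi_atTop hh)).sub (hbdd hbot)).add
    (intervalIntegral_tendsto_integral hhm tendsto_neg_atTop_atBot tendsto_id)
  rw [sub_zero, zero_add] at hR
  refine tendsto_nhds_unique hL (hR.congr' ?_)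
  filter_upwards [eventually_ge_atTop 0] with n hn using (hparts n hn).symm

/-- Hölder's inequality for `√g` and `√k`. The integrability of `f` is part of the conclusion
because the integration by parts needs it. -/
theorem integral_sq_le_of_sq_le_mul {f : ℝ → ℝ} {g k : ℝ → ℝ≥0∞}
    (hf : AEStronglyMeasurable f) (hg : AEMeasurable g) (hk : AEMeasurable k)
    (hfgk : ∀ᵐ x, ENNReal.ofReal (f x ^ 2) ≤ g x * k x)
    (hg' : ∫⁻ x, g x ≠ ⊤) (hk' : ∫⁻ x, k x ≠ ⊤) :
    Integrable f ∧ ENNReal.ofReal ((∫ x, f x) ^ 2) ≤ (∫⁻ x, g x) * ∫⁻ x, k x := by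
  have hroot : ∀ y : ℝ≥0∞, (y ^ (1 / 2 : ℝ)) ^ (2 : ℝ) = y := fun y => by
    rw [← ENNReal.rpow_mul]; norm_num
  have hsq : ∀ y : ℝ, ENNReal.ofReal (y ^ 2) = ‖y‖ₑ ^ (2 : ℝ) := fun y => by
    rw [← sq_abs, ENNReal.ofReal_pow (abs_nonneg y), ← Real.norm_eq_abs, ofReal_norm]
    norm_cast
  have hle : ∫⁻ x, ‖f x‖ₑ ≤ (∫⁻ x, g x) ^ (1 / 2 : ℝ) * (∫⁻ x, k x) ^ (1 / 2 : ℝ) := by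
    calc ∫⁻ x, ‖f x‖ₑ ≤ ∫⁻ x, ((fun x => g x ^ (1 / 2 : ℝ)) * fun x => k x ^ (1 / 2 : ℝ)) x := by
          refine lintegral_mono_ae ?_
          filter_upwards [hfgk] with x hx
          rw [Pi.mul_apply, ← ENNReal.mul_rpow_of_nonneg _ _ (by norm_num),
            one_div, ENNReal.le_rpow_inv_iff (by norm_num), ← hsq]
          exact hx
      _ ≤ _ := ENNReal.lintegral_mul_le_Lp_mul_Lq volume Real.HolderConjugate.two_two
          (hg.pow_const _) (hk.pow_const _)
      _ = _ := by simp only [hroot]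
  refine ⟨⟨hf, lt_of_le_of_lt hle (ENNReal.mul_lt_top
    (ENNReal.rpow_lt_top_of_nonneg (by norm_num) hg')
    (ENNReal.rpow_lt_top_of_nonneg (by norm_num) hk'))⟩, ?_⟩
  rw [hsq, ← hroot ((∫⁻ x, g x) * ∫⁻ x, k x), ENNReal.mul_rpow_of_nonneg _ _ (by norm_num)]
  exact ENNReal.rpow_le_rpow ((enorm_integral_le_lintegral_enorm f).trans hle) (by norm_num)

/-- A locally integrable function with the integrals of the constant `1` is a.e. equal to `1`. -/
theorem ae_eq_one_of_intervalIntegral {g : ℝ → ℝ} {a b : ℝ}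
    (hg : IntervalIntegrable g volume a b)
    (h : ∀ x ∈ Set.Ioo a b, ∫ y in a..x, g y = x - a) :
    ∀ᵐ x, x ∈ Set.Ioo a b → g x = 1 := by
  filter_upwards [hg.ae_hasDerivAt_integral] with x hx hxab
  have h1 := hx (Set.mem_uIcc.2 (Or.inl ⟨hxab.1.le, hxab.2.le⟩)) a Set.left_mem_uIcc
  have h2 : HasDerivAt (fun y => ∫ t in a..y, g t) 1 x := by
    refine ((hasDerivAt_id x).sub_const a).congr_of_eventuallyEq ?_
    filter_upwards [isOpen_Ioo.mem_nhds hxab] with y hy using h y hy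
  exact h1.unique h2

end Calculus

/-! ### Score bounds for Markov kernels and the Bayesian inequality -/

section Score

open ProbabilityTheory

variable {M : Type*} [MeasurableSpace M]

/-- `d s` is the continuous derivative of the expectation of `s`, and `F` bounds the ratio of its
square to the second moment of `s`. -/
structure IsScoreBound (κ : Kernel ℝ M) (d : SimpleFunc M ℝ → ℝ → ℝ) (F : ℝ → ℝ≥0∞) : Prop where
  hasDerivAt : ∀ s x, HasDerivAt (fun y => ∫ a, s a ∂(κ y)) (d s x) x
  continuous : ∀ s, Continuous (d s)
  div_le : ∀ s x, ENNReal.ofReal (d s x ^ 2) / ∫⁻ a, ENNReal.ofReal (s a ^ 2) ∂(κ x) ≤ F x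

theorem lintegral_sq_simpleFunc_ne_top (P : Measure M) [IsFiniteMeasure P] (s : SimpleFunc M ℝ) :
    ∫⁻ a, ENNReal.ofReal (s a ^ 2) ∂P ≠ ⊤ := by
  have h : Integrable (s.map fun c => c ^ 2) P := SimpleFunc.integrable_of_isFiniteMeasure _
  exact h.lintegral_lt_top.ne

variable {κ : Kernel ℝ M} [IsMarkovKernel κ] {d : SimpleFunc M ℝ → ℝ → ℝ} {F : ℝ → ℝ≥0∞}

/-- Linearity of `d` is not assumed; it follows from uniqueness of derivatives. -/
theorem IsScoreBound.sub (h : IsScoreBound κ d F) (s t : SimpleFunc M ℝ) (x : ℝ) :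
    d (s - t) x = d s x - d t x := by
  refine (h.hasDerivAt (s - t) x).unique ?_
  convert (h.hasDerivAt s x).fun_sub (h.hasDerivAt t x) using 1
  funext y
  exact integral_sub (SimpleFunc.integrable_of_isFiniteMeasure s)
    (SimpleFunc.integrable_of_isFiniteMeasure t)

theorem IsScoreBound.const (h : IsScoreBound κ d F) (c x : ℝ) :
    d (SimpleFunc.const M c) x = 0 := by
  refine (h.hasDerivAt (SimpleFunc.const M c) x).unique ?_
  simpa using hasDerivAt_const x c

/-- Centring does not change the score. As `x` is fixed, `c` may depend on it; `c * x` is used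
below. -/
theorem IsScoreBound.div_le_sub (h : IsScoreBound κ d F) (s : SimpleFunc M ℝ) (c x : ℝ) :
    ENNReal.ofReal (d s x ^ 2) / ∫⁻ a, ENNReal.ofReal ((s a - c) ^ 2) ∂(κ x) ≤ F x := by
  simpa [h.sub, h.const] using h.div_le (s - SimpleFunc.const M c) x

theorem IsScoreBound.sq_le (h : IsScoreBound κ d F) (s : SimpleFunc M ℝ) {x : ℝ} (hx : F x ≠ ⊤) :
    ENNReal.ofReal (d s x ^ 2) ≤ F x * ∫⁻ a, ENNReal.ofReal (s a ^ 2) ∂(κ x) :=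
  (ENNReal.div_le_iff_le_mul (Or.inr hx) (Or.inl (lintegral_sq_simpleFunc_ne_top _ s))).1
    (h.div_le s x)

theorem IsScoreBound.sub_sq_le (h : IsScoreBound κ d F) (s t : SimpleFunc M ℝ) {x : ℝ}
    (hx : F x ≠ ⊤) : ENNReal.ofReal ((d s x - d t x) ^ 2) ≤
      F x * ∫⁻ a, ENNReal.ofReal ((s a - t a) ^ 2) ∂(κ x) := by
  simpa [h.sub] using h.sq_le (s - t) hx

theorem IsScoreBound.sub_const_sq_le (h : IsScoreBound κ d F) (s : SimpleFunc M ℝ) (c : ℝ) {x : ℝ}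
    (hx : F x ≠ ⊤) : ENNReal.ofReal (d s x ^ 2) ≤
      F x * ∫⁻ a, ENNReal.ofReal ((s a - c) ^ 2) ∂(κ x) := by
  simpa [h.const] using h.sub_sq_le s (SimpleFunc.const M c) hx

/-- Used with `A = d²`, `B = q̃²`, `Q = q` and `R` the second moment of the centred function.
Finiteness of the product rules out a zero denominator below a nonzero numerator unless the other
numerator vanishes. -/
theorem mul_le_div_mul_div_mul {A B Q R : ℝ≥0∞} (hQ : Q ≠ ⊤) (hR : R ≠ ⊤)
    (h : A / R * (B / Q) ≠ ⊤) : B * A ≤ A / R * (B / Q) * (Q * R) := by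
  rcases eq_or_ne A 0 with rfl | hA
  · simp
  rcases eq_or_ne B 0 with rfl | hB
  · simp
  have hAR : A / R ≠ 0 := ENNReal.div_ne_zero.2 ⟨hA, hR⟩
  have hBQ : B / Q ≠ 0 := ENNReal.div_ne_zero.2 ⟨hB, hQ⟩
  have hR0 : R ≠ 0 := by
    rintro rfl
    exact h (by rw [ENNReal.div_zero hA, ENNReal.top_mul hBQ])
  have hQ0 : Q ≠ 0 := by
    rintro rfl
    exact h (by rw [ENNReal.div_zero hB, ENNReal.mul_top hAR])
  rw [mul_comm Q R, mul_mul_mul_comm, ENNReal.div_mul_cancel hR0 hR,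
    ENNReal.div_mul_cancel hQ0 hQ, mul_comm]

theorem measurable_lintegral_sub_sq {Φ : M → ℝ} (hΦ : Measurable Φ) (c : ℝ) :
    Measurable fun x => ∫⁻ a, ENNReal.ofReal ((Φ a - c * x) ^ 2) ∂(κ x) := by
  refine Measurable.lintegral_kernel_prod_right
    (f := fun x a => ENNReal.ofReal ((Φ a - c * x) ^ 2)) ?_
  exact (((hΦ.comp measurable_snd).sub (measurable_fst.const_mul c)).pow_const 2).ennreal_ofReal

/-- The Bayesian Cramér–Rao bound for bounded estimators with finitely many values. -/
theorem IsScoreBound.sq_integral_le (h : IsScoreBound κ d F) (s : SimpleFunc M ℝ) (c : ℝ)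
    {q : ℝ → ℝ} (hq : Measurable q) (hq1 : Integrable fun x => (x - densityMean q) * q x)
    (hq2 : ∫ x, (x - densityMean q) * q x = 0) (hF : averageFisher F q ≠ ⊤)
    (hR : ∫⁻ x, ENNReal.ofReal (q x) * ∫⁻ a, ENNReal.ofReal ((s a - c * x) ^ 2) ∂(κ x) ≠ ⊤) :
    ENNReal.ofReal
        (((∫ x, (x - densityMean q) * q x * ∫ a, s a ∂(κ x)) / densityVar q) ^ 2) ≤
      averageFisher F q *
        ∫⁻ x, ENNReal.ofReal (q x) * ∫⁻ a, ENNReal.ofReal ((s a - c * x) ^ 2) ∂(κ x) := by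
  set R : ℝ → ℝ≥0∞ := fun x => ∫⁻ a, ENNReal.ofReal ((s a - c * x) ^ 2) ∂(κ x)
  have hRm : Measurable R := measurable_lintegral_sub_sq s.measurable c
  have hRtop : ∀ x, R x ≠ ⊤ := fun x => by
    simpa using lintegral_sq_simpleFunc_ne_top (κ x) (s - SimpleFunc.const M (c * x))
  -- For zero variance the left side is `0`, by the convention for division by zero.
  rcases eq_or_ne (densityVar q) 0 with hV | hV
  · simp [hV]
  have hdm : Measurable (d s) := (h.continuous s).measurable
  have htail : Measurable (qTilde q) := by
    unfold qTilde
    refine Measurable.div_const ?_ _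
    rw [funext (setIntegral_Ioi_eq_sub hq1)]
    exact (continuous_const.sub
      (intervalIntegral.continuous_primitive (fun _ _ => hq1.intervalIntegrable) 0)).measurable
  -- `F` need not be measurable, so Hölder is applied to this measurable minorant of the integrand
  -- of `averageFisher`.
  set g : ℝ → ℝ≥0∞ := fun x => ENNReal.ofReal (d s x ^ 2) / R x *
    (ENNReal.ofReal (qTilde q x ^ 2) / ENNReal.ofReal (q x))
  have hgm : Measurable g := ((hdm.pow_const 2).ennreal_ofReal.div hRm).mul
    ((htail.pow_const 2).ennreal_ofReal.div hq.ennreal_ofReal)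
  have hgle : ∫⁻ x, g x ≤ averageFisher F q :=
    lintegral_mono fun x => mul_le_mul_left (h.div_le_sub s (c * x) x) _
  have hgtop : ∫⁻ x, g x ≠ ⊤ := ne_top_of_le_ne_top hF hgle
  have key := integral_sq_le_of_sq_le_mul (f := fun x => qTilde q x * d s x) (g := g)
    (k := fun x => ENNReal.ofReal (q x) * R x) (htail.mul hdm).aestronglyMeasurable
    hgm.aemeasurable (hq.ennreal_ofReal.mul hRm).aemeasurable
    (by
      filter_upwards [ae_lt_top hgm hgtop] with x hx
      rw [mul_pow, ENNReal.ofReal_mul (sq_nonneg _)]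
      exact mul_le_div_mul_div_mul ENNReal.ofReal_ne_top (hRtop x) hx.ne) hgtop hR
  have hbdd : ∃ C, ∀ a, ‖s a‖ ≤ C := s.exists_forall_norm_le
  obtain ⟨C, hC⟩ := hbdd
  have heq : ∀ x, qTilde q x * d s x =
      (∫ y in Set.Ioi x, (y - densityMean q) * q y) * d s x / densityVar q := fun x => by
    rw [qTilde, div_mul_eq_mul_div]
  have hint : Integrable fun x => (∫ y in Set.Ioi x, (y - densityMean q) * q y) * d s x := by
    refine (key.1.mul_const (densityVar q)).congr (ae_of_all _ fun x => ?_)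
    simp only [heq]
    exact div_mul_cancel₀ _ hV
  have hibp := integral_tail_mul_deriv hq1 hq2 (h.hasDerivAt s) (h.continuous s) (C := C)
    (fun x => (norm_integral_le_of_norm_le_const (ae_of_all _ hC)).trans (by simp)) hint
  have hval : ∫ x, qTilde q x * d s x =
      (∫ x, (x - densityMean q) * q x * ∫ a, s a ∂(κ x)) / densityVar q := by
    rw [← hibp, ← integral_div]
    exact integral_congr_ae (ae_of_all _ heq)
  rw [← hval]
  exact key.2.trans (mul_le_mul_left hgle _)

end Score

/-! ### Approximation by simple functions and unbiased estimators -/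

section Unbiased

open ProbabilityTheory

theorem tendsto_lintegral_sub_sq {T : Type*} [MeasurableSpace T] {P : Measure T}
    {u : ℕ → T → ℝ} {U f : T → ℝ} (hu : ∀ n, Measurable (u n)) (hf : AEMeasurable f P)
    (hle : ∀ n t, |u n t| ≤ 2 * |U t|) (hlim : ∀ t, Tendsto (fun n => u n t) atTop (𝓝 (U t)))
    (hU : Integrable (fun t => U t ^ 2) P) (hf2 : Integrable (fun t => f t ^ 2) P) :
    Tendsto (fun n => ∫⁻ t, ENNReal.ofReal ((u n t - f t) ^ 2) ∂P) atTop
      (𝓝 (∫⁻ t, ENNReal.ofReal ((U t - f t) ^ 2) ∂P)) := by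
  refine tendsto_lintegral_of_dominated_convergence'
    -- This dominates by `(u - f)² ≤ 2u² + 2f²` and `u² ≤ 4U²`.
    (fun t => ENNReal.ofReal (8 * U t ^ 2 + 2 * f t ^ 2))
    (fun n => (((hu n).aemeasurable.sub hf).pow_const 2).ennreal_ofReal)
    (fun n => ae_of_all _ fun t => ENNReal.ofReal_le_ofReal ?_)
    ((hU.const_mul 8).add (hf2.const_mul 2)).lintegral_lt_top.ne
    (ae_of_all _ fun t => (ENNReal.continuous_ofReal.tendsto _).comp
      (((hlim t).sub_const (f t)).pow 2))
  have h1 : u n t ^ 2 ≤ 4 * U t ^ 2 := by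
    rw [← sq_abs (u n t), ← sq_abs (U t)]
    nlinarith [hle n t, abs_nonneg (u n t), abs_nonneg (U t)]
  nlinarith [sq_nonneg (u n t + f t)]

variable {M : Type*} [MeasurableSpace M]

theorem exists_simpleFunc_tendsto {Φ : M → ℝ} (hΦ : Measurable Φ) :
    ∃ s : ℕ → SimpleFunc M ℝ, (∀ n a, |s n a| ≤ 2 * |Φ a|) ∧
      ∀ a, Tendsto (fun n => s n a) atTop (𝓝 (Φ a)) := by
  refine ⟨fun n => SimpleFunc.approxOn Φ hΦ Set.univ 0 (Set.mem_univ 0) n, fun n a => ?_,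
    fun a => SimpleFunc.tendsto_approxOn hΦ _ (by simp)⟩
  have := SimpleFunc.norm_approxOn_zero_le hΦ (Set.mem_univ 0) a n
  rw [Real.norm_eq_abs, Real.norm_eq_abs] at this
  linarith

variable {κ : Kernel ℝ M} [IsMarkovKernel κ] {d : SimpleFunc M ℝ → ℝ → ℝ} {F : ℝ → ℝ≥0∞}

/-- The scores of simple approximations of a square integrable function converge. -/
theorem IsScoreBound.cauchySeq (h : IsScoreBound κ d F) {Φ : M → ℝ}
    {s : ℕ → SimpleFunc M ℝ} (hs : ∀ n a, |s n a| ≤ 2 * |Φ a|)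
    (hs' : ∀ a, Tendsto (fun n => s n a) atTop (𝓝 (Φ a))) {x : ℝ} (hx : F x ≠ ⊤)
    (hΦ2 : Integrable (fun a => Φ a ^ 2) (κ x)) : CauchySeq fun n => d (s n) x := by
  rw [cauchySeq_iff_tendsto_dist_atTop_0]
  -- By `sub_sq_le`, differences of scores are controlled by these second moments; the dominating
  -- `16 Φ²` comes from `|s - t| ≤ 4|Φ|`.
  have hT : Tendsto (fun p : ℕ × ℕ => ∫⁻ a, ENNReal.ofReal ((s p.1 a - s p.2 a) ^ 2) ∂(κ x))
      atTop (𝓝 (∫⁻ _, 0 ∂(κ x))) := by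
    refine tendsto_lintegral_filter_of_dominated_convergence
      (fun a => ENNReal.ofReal (16 * Φ a ^ 2))
      (Eventually.of_forall fun p =>
        (((s p.1).measurable.sub (s p.2).measurable).pow_const 2).ennreal_ofReal)
      (Eventually.of_forall fun p => ae_of_all _ fun a => ENNReal.ofReal_le_ofReal ?_)
      (hΦ2.const_mul 16).lintegral_lt_top.ne (ae_of_all _ fun a => ?_)
    · have h1 := abs_sub (s p.1 a) (s p.2 a)
      have h2 := hs p.1 a
      have h3 := hs p.2 a
      rw [← sq_abs, ← sq_abs (Φ a)]
      nlinarith [abs_nonneg (s p.1 a - s p.2 a), abs_nonneg (Φ a)]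
    · have h1 : Tendsto (fun p : ℕ × ℕ => (s p.1 a - s p.2 a) ^ 2) atTop
          (𝓝 ((Φ a - Φ a) ^ 2)) := by
        rw [← prod_atTop_atTop_eq]
        exact (((hs' a).comp tendsto_fst).sub ((hs' a).comp tendsto_snd)).pow 2
      rw [sub_self, zero_pow two_ne_zero] at h1
      simpa [Function.comp_def] using (ENNReal.continuous_ofReal.tendsto _).comp h1
  have hD : Tendsto (fun p : ℕ × ℕ => ENNReal.ofReal ((d (s p.1) x - d (s p.2) x) ^ 2))
      atTop (𝓝 0) := by
    refine tendsto_of_tendsto_of_tendsto_of_le_of_le tendsto_const_nhds ?_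
      (fun _ => zero_le) (fun p => h.sub_sq_le (s p.1) (s p.2) hx)
    simpa using ENNReal.Tendsto.const_mul hT (Or.inr hx)
  have h2 := (Real.continuous_sqrt.tendsto _).comp
    ((ENNReal.tendsto_toReal ENNReal.zero_ne_top).comp hD)
  rw [ENNReal.toReal_zero, Real.sqrt_zero] at h2
  refine h2.congr fun p => ?_
  simp only [Function.comp, ENNReal.toReal_ofReal (sq_nonneg _), Real.sqrt_sq_eq_abs,
    Real.dist_eq]

/-- The Cramér–Rao bound for unbiased estimators, on an interval. -/
theorem IsScoreBound.ae_one_le_mul (h : IsScoreBound κ d F) {Φ : M → ℝ} (hΦ : Measurable Φ)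
    (hunb : ∀ x, Integrable Φ (κ x) ∧ ∫ a, Φ a ∂(κ x) = x) {a b : ℝ} {C : ℝ≥0}
    (hC : ∀ x ∈ Set.Icc a b, F x ≤ C)
    (hW : ∫⁻ x in Set.Icc a b, ∫⁻ y, ENNReal.ofReal (Φ y ^ 2) ∂(κ x) ≠ ⊤) :
    ∀ᵐ x, x ∈ Set.Ioo a b → 1 ≤ F x * ∫⁻ y, ENNReal.ofReal ((Φ y - x) ^ 2) ∂(κ x) := by
  rcases le_or_gt b a with hba | hab
  · simp [Set.Ioo_eq_empty_of_le hba]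
  obtain ⟨s, hs, hs'⟩ := exists_simpleFunc_tendsto hΦ
  set W : ℝ → ℝ≥0∞ := fun x => ∫⁻ y, ENNReal.ofReal (Φ y ^ 2) ∂(κ x)
  have hWm : Measurable W := by simpa using measurable_lintegral_sub_sq (κ := κ) hΦ 0
  have hFtop : ∀ x ∈ Set.Icc a b, F x ≠ ⊤ := fun x hx =>
    ne_top_of_le_ne_top ENNReal.coe_ne_top (hC x hx)
  have hWint : ∀ x, W x < ⊤ → Integrable (fun y => Φ y ^ 2) (κ x) := fun x hx =>
    (lintegral_ofReal_ne_top_iff_integrable (hΦ.pow_const 2).aestronglyMeasurable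
      (ae_of_all _ fun y => sq_nonneg _)).1 hx.ne
  have hWae : ∀ᵐ x ∂(volume.restrict (Set.Icc a b)), x ∈ Set.Icc a b ∧ W x < ⊤ :=
    (ae_restrict_mem measurableSet_Icc).and (ae_lt_top hWm hW)
  set g : ℝ → ℝ := fun x => limUnder atTop fun n => d (s n) x
  have hg : ∀ x, x ∈ Set.Icc a b ∧ W x < ⊤ → Tendsto (fun n => d (s n) x) atTop (𝓝 (g x)) :=
    fun x hx => CauchySeq.tendsto_limUnder (h.cauchySeq hs hs' (hFtop x hx.1) (hWint x hx.2))
  set B : ℝ → ℝ := fun x => 1 + C * 4 * (W x).toReal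
  have hB : IntegrableOn B (Set.Icc a b) := by
    have h1 := integrable_toReal_of_lintegral_ne_top hWm.aemeasurable hW
    have h2 : IntegrableOn (fun _ : ℝ => (1 : ℝ)) (Set.Icc a b) :=
      integrableOn_const (by simp)
    exact h2.add (h1.const_mul (C * 4))
  have hdB : ∀ n x, x ∈ Set.Icc a b ∧ W x < ⊤ → ‖d (s n) x‖ ≤ B x := by
    intro n x hx
    have h1 : ENNReal.ofReal (d (s n) x ^ 2) ≤ C * (4 * W x) := by
      refine (h.sq_le (s n) (hFtop x hx.1)).trans (mul_le_mul' (hC x hx.1) ?_)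
      have h4 : (4 : ℝ≥0∞) = ENNReal.ofReal 4 := by simp
      rw [h4, ← lintegral_const_mul' _ _ ENNReal.ofReal_ne_top]
      refine lintegral_mono fun y => ?_
      rw [← ENNReal.ofReal_mul (by norm_num)]
      refine ENNReal.ofReal_le_ofReal ?_
      rw [← sq_abs, ← sq_abs (Φ y)]
      nlinarith [hs n y, abs_nonneg (s n y), abs_nonneg (Φ y)]
    have h2 := ENNReal.toReal_mono (ENNReal.mul_ne_top ENNReal.coe_ne_top
      (ENNReal.mul_ne_top (by norm_num) hx.2.ne)) h1
    rw [ENNReal.toReal_ofReal (sq_nonneg _), ENNReal.toReal_mul, ENNReal.toReal_mul] at h2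
    simp only [ENNReal.coe_toReal, ENNReal.toReal_ofNat] at h2
    rw [← sq_abs] at h2
    rw [Real.norm_eq_abs]
    nlinarith [sq_nonneg (|d (s n) x| - 1)]
  have hgint : IntegrableOn g (Set.Icc a b) := by
    refine hB.mono' (aestronglyMeasurable_of_tendsto_ae atTop
      (fun n => (h.continuous (s n)).aestronglyMeasurable) (hWae.mono hg)) ?_
    filter_upwards [hWae] with x hx
    exact le_of_tendsto (hg x hx).norm (Eventually.of_forall fun n => hdB n x hx)
  have hmean : ∀ x, Tendsto (fun n => ∫ y, s n y ∂(κ x)) atTop (𝓝 x) := by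
    intro x
    have := tendsto_integral_of_dominated_convergence (μ := κ x) (F := fun n y => s n y)
      (fun y => 2 * |Φ y|) (fun n => (s n).aestronglyMeasurable)
      ((hunb x).1.abs.const_mul 2) (fun n => ae_of_all _ (hs n)) (ae_of_all _ hs')
    rwa [(hunb x).2] at this
  have hII : IntervalIntegrable g volume a b :=
    (intervalIntegrable_iff_integrableOn_Icc_of_le hab.le).2 hgint
  -- The integral of each score is an increment of the mean of `s n`; dominated convergence and
  -- unbiasedness at both endpoints give the limit.
  have hprim : ∀ x ∈ Set.Ioo a b, ∫ y in a..x, g y = x - a := by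
    intro x hx
    have hsub : Set.Ioc a x ⊆ Set.Icc a b := fun y hy => ⟨hy.1.le, hy.2.trans hx.2.le⟩
    have h1 : Tendsto (fun n => ∫ y in a..x, d (s n) y) atTop (𝓝 (∫ y in a..x, g y)) := by
      simp only [intervalIntegral.integral_of_le hx.1.le]
      have hae := ae_restrict_of_ae_restrict_of_subset hsub hWae
      exact tendsto_integral_of_dominated_convergence B
        (fun n => (h.continuous (s n)).aestronglyMeasurable) (hB.mono_set hsub)
        (fun n => hae.mono (hdB n)) (hae.mono hg)
    refine tendsto_nhds_unique h1 (((hmean x).sub (hmean a)).congr fun n => ?_)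
    exact (intervalIntegral.integral_eq_sub_of_hasDerivAt (fun y _ => h.hasDerivAt (s n) y)
      ((h.continuous (s n)).intervalIntegrable _ _)).symm
  have hWae' := (ae_restrict_iff' measurableSet_Icc).1 hWae
  filter_upwards [ae_eq_one_of_intervalIntegral hII hprim, hWae'] with x h1 h2 hx
  have hx' := h2 (Set.Ioo_subset_Icc_self hx)
  have hlim := hg x hx'
  rw [h1 hx] at hlim
  have hleft : Tendsto (fun n => ENNReal.ofReal (d (s n) x ^ 2)) atTop (𝓝 1) := by
    simpa [Function.comp_def] using (ENNReal.continuous_ofReal.tendsto _).comp (hlim.pow 2)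
  have hright := tendsto_lintegral_sub_sq (P := κ x) (f := fun _ => x)
    (fun n => (s n).measurable) aemeasurable_const hs hs' (hWint x hx'.2) (integrable_const _)
  exact le_of_tendsto_of_tendsto' hleft
    (ENNReal.Tendsto.const_mul hright (Or.inr (hFtop x hx'.1)))
    fun n => h.sub_const_sq_le (s n) x (hFtop x hx'.1)

/-- Near a point with `q > 0`, continuity keeps `q` above half its value, so the second moment of
`Φ` is integrable there, while `F` is bounded. The local estimates combine because a locally null
set is null. -/
theorem IsScoreBound.ae_inv_le (h : IsScoreBound κ d F) {Φ : M → ℝ} (hΦ : Measurable Φ)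
    (hunb : ∀ x, Integrable Φ (κ x) ∧ ∫ a, Φ a ∂(κ x) = x) {q : ℝ → ℝ} (hq : Continuous q)
    (hF : ∀ x, ∃ C : ℝ≥0, ∀ᶠ y in 𝓝 x, F y ≤ C)
    (hW : ∫⁻ x, ENNReal.ofReal (q x) * ∫⁻ y, ENNReal.ofReal (Φ y ^ 2) ∂(κ x) ≠ ⊤) :
    ∀ᵐ x, 0 < q x → (F x)⁻¹ ≤ ∫⁻ y, ENNReal.ofReal ((Φ y - x) ^ 2) ∂(κ x) := by
  set W : ℝ → ℝ≥0∞ := fun x => ∫⁻ y, ENNReal.ofReal (Φ y ^ 2) ∂(κ x)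
  set R : ℝ → ℝ≥0∞ := fun x => ∫⁻ y, ENNReal.ofReal ((Φ y - x) ^ 2) ∂(κ x)
  have hmul : ∀ᵐ x, 0 < q x → 1 ≤ F x * R x := by
    rw [ae_iff]
    refine measure_null_of_locally_null _ fun x hx => ?_
    have hqx : 0 < q x := by
      by_contra hn
      exact hx fun h0 => absurd h0 hn
    obtain ⟨C, hC⟩ := hF x
    obtain ⟨ε, hε, hball⟩ := Metric.eventually_nhds_iff_ball.1
      (hC.and (hq.continuousAt.eventually (lt_mem_nhds (half_lt_self hqx))))
    have hsub : Set.Icc (x - ε / 2) (x + ε / 2) ⊆ Metric.ball x ε := by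
      rw [Real.ball_eq_Ioo]
      exact Set.Icc_subset_Ioo (by linarith) (by linarith)
    have hloc := h.ae_one_le_mul hΦ hunb (a := x - ε / 2) (b := x + ε / 2) (C := C)
      (fun y hy => (hball y (hsub hy)).1) (by
        have h1 : ENNReal.ofReal (q x / 2) * ∫⁻ y in Set.Icc (x - ε / 2) (x + ε / 2), W y ≤
            ∫⁻ y, ENNReal.ofReal (q y) * W y := by
          rw [← lintegral_const_mul' _ _ ENNReal.ofReal_ne_top]
          refine (setLIntegral_mono' measurableSet_Icc fun y hy => ?_).trans
            (setLIntegral_le_lintegral _ _)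
          exact mul_le_mul_left (ENNReal.ofReal_le_ofReal (hball y (hsub hy)).2.le) _
        intro htop
        refine hW (top_unique (le_trans ?_ h1))
        rw [htop, ENNReal.mul_top (by simpa using hqx)])
    refine ⟨_, inter_mem_nhdsWithin _ (Ioo_mem_nhds (a := x - ε / 2) (b := x + ε / 2)
      (by linarith) (by linarith)), ?_⟩
    refine measure_mono_null (fun y hy => ?_) (ae_iff.1 hloc)
    exact fun hn => hy.1 fun _ => hn hy.2
  filter_upwards [hmul] with x hx hqx
  rw [← one_div]
  exact ENNReal.div_le_of_le_mul (by rw [mul_comm]; exact hx hqx)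

end Unbiased

/-! ### Joint law of parameter and outcome -/

section Joint

open ProbabilityTheory

variable {M : Type*} [MeasurableSpace M] {Ω : Type*} [MeasurableSpace Ω]
  {μ : Measure Ω} {φ : Ω → ℝ} {α : Ω → M} {q : ℝ → ℝ} {κ : Kernel ℝ M}

/-- The parameter `φ` has density `q`, and `κ` is the conditional law of `α` given `φ`. -/
structure IsJointLaw (μ : Measure Ω) (φ : Ω → ℝ) (α : Ω → M) (q : ℝ → ℝ) (κ : Kernel ℝ M) :
    Prop where
  meas_fst : Measurable φ
  meas_snd : Measurable α
  meas_density : Measurable q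
  density_nonneg : ∀ x, 0 ≤ q x
  map_eq : μ.map (fun ω => (φ ω, α ω)) =
    (volume.withDensity fun x => ENNReal.ofReal (q x)) ⊗ₘ κ

variable [IsMarkovKernel κ]

theorem IsJointLaw.lintegral (h : IsJointLaw μ φ α q κ) {G : ℝ → M → ℝ≥0∞}
    (hG : Measurable (Function.uncurry G)) :
    ∫⁻ ω, G (φ ω) (α ω) ∂μ = ∫⁻ x, ENNReal.ofReal (q x) * ∫⁻ a, G x a ∂(κ x) := by
  have h1 := lintegral_map (μ := μ) hG (h.meas_fst.prodMk h.meas_snd)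
  rw [h.map_eq, Measure.lintegral_compProd hG] at h1
  simp only [Function.uncurry_apply_pair] at h1
  rw [lintegral_withDensity_eq_lintegral_mul _
    h.meas_density.ennreal_ofReal hG.lintegral_kernel_prod_right] at h1
  exact h1.symm

theorem IsJointLaw.integral (h : IsJointLaw μ φ α q κ) {G : ℝ → M → ℝ}
    (hG : Measurable (Function.uncurry G)) (hint : Integrable (fun ω => G (φ ω) (α ω)) μ) :
    Integrable (fun x => q x * ∫ a, G x a ∂(κ x)) ∧
      ∫ ω, G (φ ω) (α ω) ∂μ = ∫ x, q x * ∫ a, G x a ∂(κ x) := by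
  have hpair := h.meas_fst.prodMk h.meas_snd
  have hmap : Integrable (Function.uncurry G) (μ.map fun ω => (φ ω, α ω)) :=
    (integrable_map_measure hG.aestronglyMeasurable hpair.aemeasurable).2 hint
  have h1 := integral_map hpair.aemeasurable (hG.aestronglyMeasurable (μ := μ.map _))
  rw [h.map_eq] at hmap h1
  have htop : ∀ᵐ x : ℝ, ENNReal.ofReal (q x) < ⊤ := ae_of_all _ fun _ => ENNReal.ofReal_lt_top
  have h2 := (integrable_withDensity_iff_integrable_smul' h.meas_density.ennreal_ofReal htop).1
    (((Measure.integrable_compProd_iff hmap.1).1 hmap).2.mono'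
      hG.stronglyMeasurable.integral_kernel_prod_right'.aestronglyMeasurable
      (ae_of_all _ fun x => norm_integral_le_integral_norm _))
  rw [Measure.integral_compProd hmap, integral_withDensity_eq_integral_toReal_smul
    h.meas_density.ennreal_ofReal htop] at h1
  simp only [ENNReal.toReal_ofReal (h.density_nonneg _), smul_eq_mul, Function.uncurry] at h1 h2
  exact ⟨h2, h1.symm⟩

theorem IsJointLaw.integral_fst (h : IsJointLaw μ φ α q κ) {f : ℝ → ℝ} (hf : Measurable f)
    (hint : Integrable (fun ω => f (φ ω)) μ) :
    Integrable (fun x => f x * q x) ∧ ∫ ω, f (φ ω) ∂μ = ∫ x, f x * q x := by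
  simpa [mul_comm] using h.integral (G := fun x _ => f x) (hf.comp measurable_fst) hint

theorem IsJointLaw.integral_mul (h : IsJointLaw μ φ α q κ) {Ψ : M → ℝ} (hΨ : Measurable Ψ)
    (hint : Integrable (fun ω => φ ω * Ψ (α ω)) μ) :
    ∫ ω, φ ω * Ψ (α ω) ∂μ = ∫ x, x * q x * ∫ a, Ψ a ∂(κ x) := by
  rw [(h.integral (G := fun x a => x * Ψ a) (measurable_fst.mul (hΨ.comp measurable_snd)) hint).2]
  refine integral_congr_ae (ae_of_all _ fun x => ?_)
  simp only [integral_const_mul]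
  ring

theorem IsJointLaw.ae_fst (h : IsJointLaw μ φ α q κ) {p : ℝ → Prop}
    (hp : ∀ᵐ x, 0 < q x → p x) : ∀ᵐ ω ∂μ, p (φ ω) := by
  have hfst : μ.map φ = volume.withDensity fun x => ENNReal.ofReal (q x) := by
    rw [← Measure.fst_compProd (volume.withDensity fun x => ENNReal.ofReal (q x)) κ, ← h.map_eq,
      Measure.fst_map_prodMk h.meas_snd]
  refine ae_of_ae_map h.meas_fst.aemeasurable ?_
  rw [hfst, ae_withDensity_iff h.meas_density.ennreal_ofReal]
  filter_upwards [hp] with x hx hq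
  exact hx (ENNReal.ofReal_pos.1 (pos_iff_ne_zero.2 hq))

/-- A variable with a density avoids `0` almost surely. -/
theorem IsJointLaw.integral_sq_pos [IsProbabilityMeasure μ] (h : IsJointLaw μ φ α q κ)
    (hφ2 : MemLp φ 2 μ) : 0 < ∫ ω, φ ω ^ 2 ∂μ := by
  rw [integral_pos_iff_support_of_nonneg (fun ω => sq_nonneg _) hφ2.integrable_sq]
  have h0 : ∀ᵐ ω ∂μ, φ ω ≠ 0 := h.ae_fst (p := fun x => x ≠ 0) (by
    filter_upwards [Measure.ae_ne volume (0 : ℝ)] with x hx _ using hx)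
  have h1 : μ (Function.support fun ω => φ ω ^ 2) = 1 := by
    rw [← measure_univ (μ := μ)]
    refine measure_congr ?_
    filter_upwards [h0] with ω hω
    exact propext ⟨fun _ => trivial, fun _ => pow_ne_zero 2 hω⟩
  rw [h1]
  exact one_pos

variable {d : SimpleFunc M ℝ → ℝ → ℝ} {F : ℝ → ℝ≥0∞}

/-- The Bayesian Cramér–Rao bound for the correlation of the parameter and the estimate. -/
theorem IsJointLaw.sq_corr_le [IsProbabilityMeasure μ] (h : IsJointLaw μ φ α q κ) (hd : IsScoreBound κ d F)
    (hφ2 : MemLp φ 2 μ) (hφ0 : ∫ ω, φ ω ∂μ = 0) {Φ : M → ℝ} (hΦ : Measurable Φ)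
    (hest2 : MemLp (fun ω => Φ (α ω)) 2 μ) (hF : averageFisher F q ≠ ⊤) (c : ℝ) :
    ENNReal.ofReal (((∫ ω, φ ω * Φ (α ω) ∂μ) / ∫ ω, φ ω ^ 2 ∂μ) ^ 2) ≤
      averageFisher F q * ∫⁻ ω, ENNReal.ofReal ((Φ (α ω) - c * φ ω) ^ 2) ∂μ := by
  obtain ⟨s, hs, hs'⟩ := exists_simpleFunc_tendsto hΦ
  have h1 := h.integral_fst measurable_id (hφ2.integrable one_le_two)
  have hmean : densityMean q = 0 := h1.2.symm.trans hφ0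
  have hvar : densityVar q = ∫ ω, φ ω ^ 2 ∂μ := by
    rw [(h.integral_fst (f := fun x => x ^ 2) (measurable_id.pow_const 2)
      hφ2.integrable_sq).2, densityVar, hmean]
    simp only [sub_zero]
  have hprod : Integrable (fun ω => φ ω * Φ (α ω)) μ := hφ2.integrable_mul hest2
  have hdom : ∀ n, ∀ ω, ‖φ ω * s n (α ω)‖ ≤ 2 * |φ ω * Φ (α ω)| := by
    intro n ω
    rw [Real.norm_eq_abs, abs_mul, abs_mul]
    nlinarith [mul_le_mul_of_nonneg_left (hs n (α ω)) (abs_nonneg (φ ω))]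
  have hmeas : ∀ n, AEStronglyMeasurable (fun ω => φ ω * s n (α ω)) μ := fun n =>
    (h.meas_fst.mul ((s n).measurable.comp h.meas_snd)).aestronglyMeasurable
  have hright := tendsto_lintegral_sub_sq (P := μ) (u := fun n ω => s n (α ω))
    (f := fun ω => c * φ ω) (fun n => (s n).measurable.comp h.meas_snd)
    (h.meas_fst.const_mul c).aemeasurable (fun n ω => hs n (α ω)) (fun ω => hs' (α ω))
    hest2.integrable_sq (hφ2.const_mul c).integrable_sq
  have hleft := tendsto_integral_of_dominated_convergence (F := fun n ω => φ ω * s n (α ω))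
    (fun ω => 2 * |φ ω * Φ (α ω)|) hmeas (hprod.abs.const_mul 2) (fun n => ae_of_all _ (hdom n))
    (ae_of_all _ fun ω => (hs' (α ω)).const_mul (φ ω))
  -- Finiteness of `F̃` lets the product with it pass to the limit; the inequality remains to be
  -- shown for each `s n`.
  refine le_of_tendsto_of_tendsto' ((ENNReal.continuous_ofReal.tendsto _).comp
    ((hleft.div_const (∫ ω, φ ω ^ 2 ∂μ)).pow 2))
    (ENNReal.Tendsto.const_mul hright (Or.inr hF)) fun n => ?_
  have hint : Integrable (fun ω => φ ω * s n (α ω)) μ :=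
    (hprod.abs.const_mul 2).mono' (hmeas n) (ae_of_all _ (hdom n))
  have hsq : MemLp (fun ω => s n (α ω) - c * φ ω) 2 μ := by
    refine MemLp.sub ?_ (hφ2.const_mul c)
    obtain ⟨C, hC⟩ := (s n).exists_forall_norm_le
    exact MemLp.of_bound ((s n).measurable.comp h.meas_snd).aestronglyMeasurable C
      (ae_of_all _ fun ω => hC (α ω))
  have hR := h.lintegral (G := fun x a => ENNReal.ofReal ((s n a - c * x) ^ 2))
    ((((s n).measurable.comp measurable_snd).sub
      (measurable_fst.const_mul c)).pow_const 2).ennreal_ofReal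
  have key := hd.sq_integral_le (s n) c h.meas_density
    (by simpa [hmean] using h1.1) (by simpa [hmean] using h1.2.symm.trans hφ0) hF
    (by rw [← hR]; exact hsq.integrable_sq.lintegral_lt_top.ne)
  simp only [Function.comp, h.integral_mul (s n).measurable hint, hR]
  simpa only [hmean, hvar, sub_zero] using key

/-- The choice `c = 1 - ζ` is the regression coefficient of the estimate on `φ`, which makes the
residual `r` orthogonal to `φ`. -/
theorem IsJointLaw.bayesian_bound [IsProbabilityMeasure μ] (h : IsJointLaw μ φ α q κ) (hd : IsScoreBound κ d F)
    (hφ2 : MemLp φ 2 μ) (hφ0 : ∫ ω, φ ω ∂μ = 0) {Φ : M → ℝ} (hΦ : Measurable Φ)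
    (hest2 : MemLp (fun ω => Φ (α ω)) 2 μ) {ζ : ℝ}
    (hζ : ζ = (∫ ω, (φ ω - Φ (α ω)) * φ ω ∂μ) / ∫ ω, φ ω ^ 2 ∂μ) :
    ENNReal.ofReal ((1 - ζ) ^ 2) * (averageFisher F q)⁻¹
        + ENNReal.ofReal (ζ ^ 2 * ∫ ω, φ ω ^ 2 ∂μ)
      ≤ ENNReal.ofReal (∫ ω, (φ ω - Φ (α ω)) ^ 2 ∂μ) := by
  have hV := h.integral_sq_pos hφ2
  have hprod : Integrable (fun ω => φ ω * Φ (α ω)) μ := hφ2.integrable_mul hest2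
  have hCV : (∫ ω, φ ω * Φ (α ω) ∂μ) = (1 - ζ) * ∫ ω, φ ω ^ 2 ∂μ := by
    have : ∫ ω, (φ ω - Φ (α ω)) * φ ω ∂μ = (∫ ω, φ ω ^ 2 ∂μ) - ∫ ω, φ ω * Φ (α ω) ∂μ := by
      rw [← integral_sub hφ2.integrable_sq hprod]
      exact integral_congr_ae (ae_of_all _ fun ω => by ring)
    rw [this] at hζ
    rw [hζ]
    field_simp
    ring
  set r : Ω → ℝ := fun ω => Φ (α ω) - (1 - ζ) * φ ω
  have hr2 : MemLp r 2 μ := hest2.sub (hφ2.const_mul (1 - ζ))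
  have hdecomp : ∫ ω, (φ ω - Φ (α ω)) ^ 2 ∂μ =
      (∫ ω, r ω ^ 2 ∂μ) + ζ ^ 2 * ∫ ω, φ ω ^ 2 ∂μ := by
    have e1 : ∀ ω, (φ ω - Φ (α ω)) ^ 2 = r ω ^ 2 + (ζ ^ 2 + 2 * ζ * (1 - ζ)) * φ ω ^ 2
        - 2 * ζ * (φ ω * Φ (α ω)) := fun ω => by simp only [r]; ring
    have hadd : Integrable
        (fun ω => r ω ^ 2 + (ζ ^ 2 + 2 * ζ * (1 - ζ)) * φ ω ^ 2) μ :=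
      hr2.integrable_sq.add (hφ2.integrable_sq.const_mul _)
    simp only [e1]
    rw [integral_sub hadd (hprod.const_mul _), integral_add hr2.integrable_sq (hφ2.integrable_sq.const_mul _),
      integral_const_mul, integral_const_mul, hCV]
    ring
  rw [hdecomp, ENNReal.ofReal_add (integral_nonneg fun ω => sq_nonneg _) (by positivity)]
  refine add_le_add_left ?_ _
  rcases eq_or_ne (averageFisher F q) ⊤ with hF | hF
  · simp [hF]
  have key := h.sq_corr_le hd hφ2 hφ0 hΦ hest2 hF (1 - ζ)
  rw [hCV, mul_div_cancel_right₀ _ hV.ne', ← ofReal_integral_eq_lintegral_ofReal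
    hr2.integrable_sq (ae_of_all _ fun ω => sq_nonneg _)] at key
  rw [← div_eq_mul_inv]
  exact ENNReal.div_le_of_le_mul' key

/-- Conditioning on `φ` gives `E[φ Φ(α)] = E[φ²]`, hence `ζ = 0`, and only the pointwise bound on `1
/ F` has to be integrated. -/
theorem IsJointLaw.unbiased_bound (h : IsJointLaw μ φ α q κ) (hd : IsScoreBound κ d F)
    (hφ2 : MemLp φ 2 μ) {Φ : M → ℝ} (hΦ : Measurable Φ)
    (hest2 : MemLp (fun ω => Φ (α ω)) 2 μ) {ζ : ℝ}
    (hζ : ζ = (∫ ω, (φ ω - Φ (α ω)) * φ ω ∂μ) / ∫ ω, φ ω ^ 2 ∂μ)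
    (hq : Continuous q) (hF : ∀ x, ∃ C : ℝ≥0, ∀ᶠ y in 𝓝 x, F y ≤ C)
    (hunb : ∀ x, Integrable Φ (κ x) ∧ ∫ a, Φ a ∂(κ x) = x) :
    ENNReal.ofReal ((1 - ζ) ^ 2) * (∫⁻ ω, (F (φ ω))⁻¹ ∂μ)
        + ENNReal.ofReal (ζ ^ 2 * ∫ ω, φ ω ^ 2 ∂μ)
      ≤ ENNReal.ofReal (∫ ω, (φ ω - Φ (α ω)) ^ 2 ∂μ) := by
  have hprod : Integrable (fun ω => φ ω * Φ (α ω)) μ := hφ2.integrable_mul hest2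
  have hζ0 : ζ = 0 := by
    have h1 : ∫ ω, φ ω * Φ (α ω) ∂μ = ∫ ω, φ ω ^ 2 ∂μ := by
      rw [h.integral_mul hΦ hprod, (h.integral_fst (f := fun x => x ^ 2)
        (measurable_id.pow_const 2) hφ2.integrable_sq).2]
      refine integral_congr_ae (ae_of_all _ fun x => ?_)
      simp only [(hunb x).2]
      ring
    have h2 : ∫ ω, (φ ω - Φ (α ω)) * φ ω ∂μ =
        (∫ ω, φ ω ^ 2 ∂μ) - ∫ ω, φ ω * Φ (α ω) ∂μ := by
      rw [← integral_sub hφ2.integrable_sq hprod]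
      exact integral_congr_ae (ae_of_all _ fun ω => by ring)
    rw [hζ, h2, h1, sub_self, zero_div]
  have hW := h.lintegral (G := fun _ a => ENNReal.ofReal (Φ a ^ 2))
    ((hΦ.comp measurable_snd).pow_const 2).ennreal_ofReal
  have hae := h.ae_fst (hd.ae_inv_le hΦ hunb hq hF
    (by rw [← hW]; exact hest2.integrable_sq.lintegral_lt_top.ne))
  have hRm : Measurable fun x => ∫⁻ a, ENNReal.ofReal ((Φ a - x) ^ 2) ∂(κ x) := by
    simpa using measurable_lintegral_sub_sq (κ := κ) hΦ 1
  have hR : ∫⁻ ω, (∫⁻ a, ENNReal.ofReal ((Φ a - φ ω) ^ 2) ∂(κ (φ ω))) ∂μ =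
      ∫⁻ ω, ENNReal.ofReal ((Φ (α ω) - φ ω) ^ 2) ∂μ := by
    rw [h.lintegral (G := fun x _ => ∫⁻ a, ENNReal.ofReal ((Φ a - x) ^ 2) ∂(κ x))
        (hRm.comp measurable_fst),
      h.lintegral (G := fun x a => ENNReal.ofReal ((Φ a - x) ^ 2))
        (((hΦ.comp measurable_snd).sub measurable_fst).pow_const 2).ennreal_ofReal]
    simp
  have hdiff : MemLp (fun ω => φ ω - Φ (α ω)) 2 μ := hφ2.sub hest2
  simp only [hζ0, sub_zero, one_pow, ENNReal.ofReal_one, one_mul, zero_pow two_ne_zero, zero_mul,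
    ENNReal.ofReal_zero, add_zero]
  rw [ofReal_integral_eq_lintegral_ofReal hdiff.integrable_sq (ae_of_all _ fun ω => sq_nonneg _)]
  refine (lintegral_mono_ae hae).trans_eq (hR.trans ?_)
  exact lintegral_congr fun ω => by rw [← neg_sub, neg_sq]

end Joint

/-! ### The measurement as a Markov kernel -/

section Quantum

open ProbabilityTheory

variable {H : Type*} [NormedAddCommGroup H] [InnerProductSpace ℂ H] [CompleteSpace H]
variable {M : Type*} [MeasurableSpace M]

/-- The outcome laws of a measurement on a family of states, as a Markov kernel. -/
noncomputable def outcomeKernel {ρ : ℝ → State H} {ρ' : ℝ → H →L[ℂ] H}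
    (hρ : IsContDiffFamily ρ ρ') (E : POVM M H) : Kernel ℝ M :=
  ⟨fun x => outcomeLaw (ρ x) E, measurable_outcomeLaw hρ E⟩

instance isMarkovKernel_outcomeKernel {ρ : ℝ → State H} {ρ' : ℝ → H →L[ℂ] H}
    (hρ : IsContDiffFamily ρ ρ') (E : POVM M H) : IsMarkovKernel (outcomeKernel hρ E) :=
  ⟨fun x => isProbabilityMeasure_outcomeLaw (ρ x) E⟩

theorem isScoreBound_outcomeKernel {ρ : ℝ → State H} {ρ' : ℝ → H →L[ℂ] H}
    (hρ : IsContDiffFamily ρ ρ') (E : POVM M H) :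
    IsScoreBound (outcomeKernel hρ E) (fun s x => scoreSum (ρ' x) E s)
      fun x => quantumFisher (ρ x) (ρ' x) :=
  ⟨hasDerivAt_integral_simpleFunc hρ E, continuous_scoreSum hρ E,
    fun s x => scoreSum_sq_div_le (ρ x) (ρ' x) E s⟩

/-- Finite measures on a product are determined by their values on rectangles. -/
theorem IsMeasuredParameter.isJointLaw {Ω : Type*} [MeasurableSpace Ω] {μ : Measure Ω}
    [IsProbabilityMeasure μ] {φ : Ω → ℝ} (hφ : Measurable φ) {α : Ω → M} (hα : Measurable α)
    {q : ℝ → ℝ} (hq : Measurable q) (hq0 : ∀ x, 0 ≤ q x) {ρ : ℝ → State H} {ρ' : ℝ → H →L[ℂ] H}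
    (hρ : IsContDiffFamily ρ ρ') {E : POVM M H} (h : IsMeasuredParameter μ φ α q ρ E) :
    IsJointLaw μ φ α q (outcomeKernel hρ E) := by
  refine ⟨hφ, hα, hq, hq0, ?_⟩
  have hpair := hφ.prodMk hα
  have : IsProbabilityMeasure (μ.map fun ω => (φ ω, α ω)) :=
    Measure.isProbabilityMeasure_map hpair.aemeasurable
  refine Measure.ext_prod fun {B A} hB hA => ?_
  rw [Measure.map_apply hpair (hB.prod hA), Measure.compProd_apply_prod hB hA,
    setLIntegral_withDensity_eq_setLIntegral_mul _ hq.ennreal_ofReal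
      (Kernel.measurable_coe _ hA) hB]
  exact h B A hB hA

end Quantum

end QuantumEstimation

theorem mainTheorem6
    {H : Type*} [NormedAddCommGroup H] [InnerProductSpace ℂ H] [CompleteSpace H]
    {M : Type*} [MeasurableSpace M] {Ω : Type*} [MeasurableSpace Ω]
    (ρ : ℝ → State H) (ρ' : ℝ → H →L[ℂ] H) (hρ : IsContDiffFamily ρ ρ')
    (F : ℝ → ℝ≥0∞) (hF : ∀ x, F x = quantumFisher (ρ x) (ρ' x))
    (E : POVM M H) (Φ : M → ℝ) (hΦ : Measurable Φ)
    (μ : Measure Ω) [IsProbabilityMeasure μ]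
    (φ : Ω → ℝ) (hφ : Measurable φ) (α : Ω → M) (hα : Measurable α)
    (q : ℝ → ℝ) (hq : Measurable q) (hq0 : ∀ x, 0 ≤ q x)
    (hlaw : IsMeasuredParameter μ φ α q ρ E)
    (hφ2 : MemLp φ 2 μ) (hφ0 : ∫ ω, φ ω ∂μ = 0) (hest2 : MemLp (fun ω => Φ (α ω)) 2 μ)
    (ζ : ℝ) (hζ : ζ = (∫ ω, (φ ω - Φ (α ω)) * φ ω ∂μ) / ∫ ω, φ ω ^ 2 ∂μ) :
    ENNReal.ofReal ((1 - ζ) ^ 2) * (averageFisher F q)⁻¹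
        + ENNReal.ofReal (ζ ^ 2 * ∫ ω, φ ω ^ 2 ∂μ)
      ≤ ENNReal.ofReal (∫ ω, (φ ω - Φ (α ω)) ^ 2 ∂μ) ∧
    (Continuous q → (∀ x, ∃ C : ℝ≥0, ∀ᶠ y in 𝓝 x, F y ≤ C) → IsUnbiased ρ E Φ →
      ENNReal.ofReal ((1 - ζ) ^ 2) * (∫⁻ ω, (F (φ ω))⁻¹ ∂μ)
          + ENNReal.ofReal (ζ ^ 2 * ∫ ω, φ ω ^ 2 ∂μ)
        ≤ ENNReal.ofReal (∫ ω, (φ ω - Φ (α ω)) ^ 2 ∂μ)) := by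
  obtain rfl : F = fun x => quantumFisher (ρ x) (ρ' x) := funext hF
  have hjoint := hlaw.isJointLaw hφ hα hq hq0 hρ
  have hscore := isScoreBound_outcomeKernel hρ E
  exact ⟨hjoint.bayesian_bound hscore hφ2 hφ0 hΦ hest2 hζ, fun hqc hFb hunb =>
    hjoint.unbiased_bound hscore hφ2 hΦ hest2 hζ hqc hFb hunb⟩
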